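/- Call a drawing of a graph in the plane a planar straight-line drawing if the vertices are drawn as distinct points, each edge is drawn as the straight-line segment between its two ends, edges meet at most in common end points, and no edge passes through a vertex other than its ends. The faces of the drawing are the connected components of its complement, and the outer face is the unbounded one. A graph with such a drawing is internally 3-connected if it is 2-connected and, for every pair of vertices $u\ne v$ such that $G-u-v$ is disconnected, both $u$ and $v$ lie on the outer face and every connected component of $G-u-v$ contains a vertex of the outer face. A planar straight-line drawing is convex if every face is bounded by a convex polygon; flat angles are allowed, so strictly convex drawings are included. A linear morphing step from a drawing $\Gamma$ to a drawing $\Gamma'$ moves every vertex along a straight line at constant speed during the time interval $[0,1]$, and it is planar if the drawing is a planar straight-line drawing at all times $t\in[0,1]$. A planar morph composed of a sequence of linear morphing steps is convexifying if its final drawing is convex. **Theorem.** For every $n\ge 3$ there is a planar straight-line drawing $\Gamma_n$ of an internally 3-connected graph on $n$ vertices such that any convexifying planar morph that starts at $\Gamma_n$ and is composed of a sequence of linear morphing steps requires $\Omega(n)$ steps. That is, there are a constant $c>0$ and an $N$ such that, for all $n\ge N$, every such morph of $\Gamma_n$ has at least $cn$ steps. Moreover, $\Gamma_n$ can be taken to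 be a drawing of the cycle on $n$ vertices in which the path formed by some $\lfloor n/2\rfloor$ consecutive vertices $a_1,\dots,a_{\lfloor n/2\rfloor}$ is a triangular spiral: for each $i$, the edge from $a_i$ to $a_{i+1}$ points in the direction of angle $2\pi(i-1)/3$. -/

import Mathlib

open Filter

/-! Straight-line drawings of a graph `G` with vertex set `V` are maps `p : V → ℂ`; the field `ℂ`
with its real structure is the Euclidean plane. -/

namespace PlaneDrawing

variable {V : Type*}

/-- `p` is a planar straight-line drawing of `G`: distinct vertices are distinct points, an edge
passes through no vertex other than its two ends, and distinct edges have disjoint relative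
interiors (so that they meet at most in a common end). -/
structure IsPlanarDrawing (G : SimpleGraph V) (p : V → ℂ) : Prop where
  injective : Function.Injective p
  vertex_edge : ∀ u v w : V, G.Adj u v → p w ∈ segment ℝ (p u) (p v) → w = u ∨ w = v
  edge_edge : ∀ u v w x : V, G.Adj u v → G.Adj w x → s(u, v) ≠ s(w, x) →
    Disjoint (openSegment ℝ (p u) (p v)) (openSegment ℝ (p w) (p x))

/-- The set of points of the plane covered by the drawing. -/
def drawingSet (G : SimpleGraph V) (p : V → ℂ) : Set ℂ :=
  {z | (∃ v, z = p v) ∨ ∃ u v, G.Adj u v ∧ z ∈ segment ℝ (p u) (p v)}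

/-- The faces of a drawing: the connected components of its complement. -/
def faces (G : SimpleGraph V) (p : V → ℂ) : Set (Set ℂ) :=
  {F | ∃ z ∈ (drawingSet G p)ᶜ, F = connectedComponentIn (drawingSet G p)ᶜ z}

/-- The vertex `v` lies on (the boundary of) the outer, i.e. unbounded, face. -/
def OnOuterFace (G : SimpleGraph V) (p : V → ℂ) (v : V) : Prop :=
  ∃ F ∈ faces G p, ¬ Bornology.IsBounded F ∧ p v ∈ frontier F

/-- `G` is 2-connected: it has at least three vertices, is connected, and stays connected after
the deletion of any one vertex. -/
def IsTwoConnected (G : SimpleGraph V) : Prop :=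
  3 ≤ Nat.card V ∧ G.Connected ∧ ∀ v : V, (G.induce ({v}ᶜ : Set V)).Connected

/-- `{u, v}` is a separation pair of `G`: the graph `G - u - v` is disconnected. -/
def IsSeparationPair (G : SimpleGraph V) (u v : V) : Prop :=
  u ≠ v ∧ ¬ (G.induce ({u, v}ᶜ : Set V)).Preconnected

/-- The pair `{u, v}` is external: `u` and `v` lie on the outer face, and so does at least one
vertex of every connected component of `G - u - v`. -/
def IsExternalPair (G : SimpleGraph V) (p : V → ℂ) (u v : V) : Prop :=
  OnOuterFace G p u ∧ OnOuterFace G p v ∧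
    ∀ C : (G.induce ({u, v}ᶜ : Set V)).ConnectedComponent,
      ∃ w : ({u, v}ᶜ : Set V), w ∈ C.supp ∧ OnOuterFace G p w

/-- The plane graph given by the drawing `p` of `G` is internally 3-connected. -/
def IsInternallyThreeConnected (G : SimpleGraph V) (p : V → ℂ) : Prop :=
  IsTwoConnected G ∧ ∀ u v : V, IsSeparationPair G u v → IsExternalPair G p u v

/-- A convex drawing: a planar drawing in which every face is bounded by a convex polygon.
Bounded faces are convex, and the outer face is the complement of a convex set with nonempty
interior. So angles of inner faces are at most `π` and angles of the outer face are at least `π`;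
flat angles are allowed. -/
structure IsConvexDrawing (G : SimpleGraph V) (p : V → ℂ) : Prop where
  planar : IsPlanarDrawing G p
  inner : ∀ F ∈ faces G p, Bornology.IsBounded F → Convex ℝ F
  outer : ∀ F ∈ faces G p, ¬ Bornology.IsBounded F → Convex ℝ Fᶜ ∧ (interior Fᶜ).Nonempty

/-- A strictly convex drawing: a convex drawing in which every vertex on the boundary of a face is
a corner of the convex polygon bounding that face, i.e. without flat angles. It is in particular
a convex drawing. -/
structure IsStrictlyConvexDrawing (G : SimpleGraph V) (p : V → ℂ) : Prop
    extends IsConvexDrawing G p where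
  inner_corner : ∀ F ∈ faces G p, Bornology.IsBounded F →
    ∀ v, p v ∈ frontier F → p v ∈ (closure F).extremePoints ℝ
  outer_corner : ∀ F ∈ faces G p, ¬ Bornology.IsBounded F →
    ∀ v, p v ∈ frontier F → p v ∈ (Fᶜ).extremePoints ℝ

/-- The drawing at time `t` of the linear morph from `p` to `q`: every vertex moves along a
straight line at constant speed. -/
noncomputable def linearMorph (p q : V → ℂ) (t : ℝ) : V → ℂ :=
  fun v => AffineMap.lineMap (p v) (q v) t

/-- The linear morph from `p` to `q` is planar: the drawing is planar at all times. -/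
def IsPlanarLinearMorph (G : SimpleGraph V) (p q : V → ℂ) : Prop :=
  ∀ t ∈ Set.Icc (0 : ℝ) 1, IsPlanarDrawing G (linearMorph p q t)

/-- `Δ 0, …, Δ k` are the successive drawings of a planar morph that starts at `p`, is composed of
`k` linear morphing steps, and ends in a convex drawing, strictly convex or not. The values `Δ i`
with `k < i` play no role. -/
structure IsConvexifyingMorph (G : SimpleGraph V) (p : V → ℂ) (k : ℕ) (Δ : ℕ → V → ℂ) : Prop where
  start : Δ 0 = p
  step : ∀ i < k, IsPlanarLinearMorph G (Δ i) (Δ (i + 1))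
  convex : IsConvexDrawing G (Δ k)

/-- The first `m` of the points `p 0, p 1, …` form a triangular spiral: consecutive edges of the
path they form point in the directions `0, 2π/3, 4π/3, 0, 2π/3, 4π/3, …`. (If the path does not
cross itself, then it winds around in this way for its whole length.) -/
def IsTriangularSpiral {n : ℕ} (m : ℕ) (p : Fin n → ℂ) : Prop :=
  ∀ i j : Fin n, (j : ℕ) = i + 1 → (j : ℕ) < m →
    ∃ r : ℝ, 0 < r ∧
      p j - p i = (r : ℂ) * Complex.exp ((2 * Real.pi * (i : ℕ) / 3 : ℝ) * Complex.I)

end PlaneDrawing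

/-!
The lower bound comes from the total turning of a path of the cycle, the sum of its signed exterior
angles. In a planar drawing no path folds back, so each exterior angle, and with it the total
turning, varies continuously during a planar morph. The total turning is a lift of the direction of
the last edge relative to the first one, and during a linear step an edge vector moves along a
segment that avoids `0`, hence rotates by less than `π`. So a linear step changes the total turning
by less than `2π` (`IsPlanarLinearMorph.abs_totalTurning_sub_lt`).

In a convex drawing of a cycle no path turns by more than `2π`
(`IsConvexDrawing.abs_totalTurning_le`). For this, let `K` be the complement of the outer face, a
convex body whose boundary is covered by the drawing. An edge with an inner point on the boundary of
`K` lies on it entirely, by a supporting line, and the boundary cannot end at a vertex, because it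
is a topological circle and one inner point of an edge does not disconnect it. Hence all edges lie
on the boundary of `K`, the drawing is on one side of the line through each edge, and this side is
the same for all edges; a path with this property does not turn beyond `2π`.

A triangular spiral with `m` vertices has total turning `2π (m - 2) / 3`, and so a convexifying
morph has at least `(m - 5) / 3` steps.

The drawing is a thin strip along the logarithmic spiral through the points `(4 ω) ^ k`, where `ω`
is a primitive third root of unity. All vertices lie on three rays, and apart from one edge for odd
`n`, every edge crosses one of the three sectors between them. The edges in a sector are linearly
ordered by their distance from the centre, which gives planarity. All vertices are on the outer face
since they lie in the closure of the strip between consecutive windings (`corridor`), which is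
connected, unbounded and disjoint from the drawing.
-/

namespace PlaneDrawing

/-! ### Total turning of a polygonal path -/

/-- The total turning of a polygonal path along its edge vectors `e 0, …, e N`: the sum of the
signed exterior angles at its inner vertices, each taken in `(-π, π]`. -/
noncomputable def totalTurning (e : ℕ → ℂ) (N : ℕ) : ℝ :=
  ∑ i ∈ Finset.range N, Complex.arg (e (i + 1) / e i)

/-- The total turning is a lift of the direction of the last edge relative to the first. -/
lemma coe_totalTurning {e : ℕ → ℂ} {N : ℕ} (he : ∀ i ≤ N, e i ≠ 0) :
    (totalTurning e N : Real.Angle) = (Complex.arg (e N) : Real.Angle) - Complex.arg (e 0) := by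
  induction N with
  | zero => simp [totalTurning]
  | succ N ih =>
    have h1 := ih fun i hi => he i (by omega)
    rw [totalTurning] at h1 ⊢
    rw [Finset.sum_range_succ, Real.Angle.coe_add, h1,
      Complex.arg_div_coe_angle (he _ le_rfl) (he _ (by omega))]
    abel

lemma totalTurning_conj {e : ℕ → ℂ} {N : ℕ}
    (hs : ∀ i < N, e (i + 1) / e i ∈ Complex.slitPlane) :
    totalTurning (fun i => (starRingEnd ℂ) (e i)) N = -totalTurning e N := by
  unfold totalTurning
  rw [← Finset.sum_neg_distrib]
  refine Finset.sum_congr rfl fun i hi => ?_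
  rw [← map_div₀, Complex.arg_conj,
    if_neg (Complex.mem_slitPlane_iff_arg.1 (hs i (Finset.mem_range.1 hi))).1]

lemma lineMap_one_mem_slitPlane {w : ℂ} (hw : ∀ t ∈ Set.Icc (0 : ℝ) 1, AffineMap.lineMap 1 w t ≠ 0)
    {t : ℝ} (ht : t ∈ Set.Icc (0 : ℝ) 1) : AffineMap.lineMap 1 w t ∈ Complex.slitPlane := by
  have hw0 : w ∈ Complex.slitPlane := by
    by_contra h
    rw [Complex.mem_slitPlane_iff] at h
    push Not at h
    have h1 : 0 < 1 - w.re := by linarith [h.1]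
    refine hw (1 / (1 - w.re)) ⟨by positivity, ?_⟩ ?_
    · rw [div_le_one h1]; linarith [h.1]
    · rw [AffineMap.lineMap_apply_module]
      apply Complex.ext
      · simp only [Complex.add_re, Complex.real_smul, Complex.re_ofReal_mul, Complex.one_re,
          Complex.zero_re]
        field_simp
        ring
      · simp only [Complex.add_im, Complex.real_smul, Complex.im_ofReal_mul, Complex.one_im,
          Complex.zero_im, h.2]
        ring
  have := Complex.starConvex_one_slitPlane.segment_subset hw0
  exact this (by rw [segment_eq_image_lineMap]; exact ⟨t, ht, rfl⟩)

lemma abs_arg_lt_pi {z : ℂ} (hz : z ∈ Complex.slitPlane) : |Complex.arg z| < Real.pi :=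
  abs_lt.2 ⟨Complex.neg_pi_lt_arg z,
    (Complex.arg_le_pi z).lt_of_ne (Complex.mem_slitPlane_iff_arg.1 hz).1⟩

/-- If the edge vectors of a path move linearly, never vanish and consecutive ones never become
opposite, then the total turning changes by less than `2π`: relative to its initial direction, each
of the two extreme edges rotates by less than `π`, and the total turning is a continuous lift. -/
lemma abs_totalTurning_sub_lt {e e' : ℕ → ℂ} {N : ℕ}
    (h0 : ∀ t ∈ Set.Icc (0 : ℝ) 1, ∀ i ≤ N, AffineMap.lineMap (e i) (e' i) t ≠ 0)
    (hs : ∀ t ∈ Set.Icc (0 : ℝ) 1, ∀ i < N,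
      AffineMap.lineMap (e (i + 1)) (e' (i + 1)) t / AffineMap.lineMap (e i) (e' i) t
        ∈ Complex.slitPlane) :
    |totalTurning e' N - totalTurning e N| < 2 * Real.pi := by
  have z0 : (0 : ℝ) ∈ Set.Icc (0 : ℝ) 1 := by simp
  have z1 : (1 : ℝ) ∈ Set.Icc (0 : ℝ) 1 := by simp
  have he : ∀ i ≤ N, e i ≠ 0 := fun i hi => by simpa using h0 0 z0 i hi
  have hmul : ∀ t : ℝ, ∀ i ≤ N, AffineMap.lineMap (e i) (e' i) t =
      e i * AffineMap.lineMap 1 (e' i / e i) t := by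
    intro t i hi
    have := he i hi
    simp only [AffineMap.lineMap_apply_module, Complex.real_smul]
    field_simp
  have hslit : ∀ i ≤ N, ∀ t ∈ Set.Icc (0 : ℝ) 1,
      AffineMap.lineMap 1 (e' i / e i) t ∈ Complex.slitPlane := by
    intro i hi t ht
    refine lineMap_one_mem_slitPlane (fun s hs' h => ?_) ht
    exact h0 s hs' i hi (by rw [hmul s i hi, h, mul_zero])
  set E : ℝ → ℕ → ℂ := fun t i => AffineMap.lineMap (e i) (e' i) t with hE
  have hEc : ∀ i, Continuous fun t => E t i := fun i => AffineMap.lineMap_continuous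
  set r : ℕ → ℝ → ℝ := fun i t => Complex.arg (AffineMap.lineMap 1 (e' i / e i) t) with hr
  have hrc : ∀ i ≤ N, ContinuousOn (r i) (Set.Icc 0 1) := by
    intro i hi t ht
    have : ContinuousAt Complex.arg (AffineMap.lineMap 1 (e' i / e i) t) :=
      Complex.continuousAt_arg (hslit i hi t ht)
    exact (this.comp (f := fun t : ℝ => AffineMap.lineMap 1 (e' i / e i) t)
      AffineMap.lineMap_continuous.continuousAt).continuousWithinAt
  set g : ℝ → ℝ := fun t => totalTurning (E t) N - totalTurning e N - (r N t - r 0 t) with hg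
  have hgc : ContinuousOn g (Set.Icc 0 1) := by
    refine ((ContinuousOn.sub ?_ continuousOn_const).sub ((hrc N le_rfl).sub (hrc 0 N.zero_le)))
    refine continuousOn_finsetSum _ fun i hi => ?_
    have hi := Finset.mem_range.1 hi
    intro t ht
    refine ContinuousWithinAt.comp (t := Set.univ) (g := Complex.arg)
      (Complex.continuousAt_arg (hs t ht i hi)).continuousWithinAt ?_ (fun _ _ => trivial)
    exact ((hEc (i + 1)).continuousAt.div (hEc i).continuousAt
      (h0 t ht i hi.le)).continuousWithinAt
  have hgT : Set.MapsTo g (Set.Icc 0 1) (AddSubgroup.zmultiples (2 * Real.pi) : Set ℝ) := by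
    intro t ht
    have : ((g t : ℝ) : Real.Angle) = 0 := by
      simp only [hg, Real.Angle.coe_sub]
      rw [coe_totalTurning (fun i hi => h0 t ht i hi), coe_totalTurning he]
      simp only [hr]
      rw [hmul t N le_rfl, hmul t 0 N.zero_le,
        Complex.arg_mul_coe_angle (he _ le_rfl) (Complex.slitPlane_ne_zero (hslit _ le_rfl t ht)),
        Complex.arg_mul_coe_angle (he _ N.zero_le)
          (Complex.slitPlane_ne_zero (hslit _ N.zero_le t ht))]
      abel
    obtain ⟨k, hk⟩ := Real.Angle.coe_eq_zero_iff.1 this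
    exact ⟨k, hk⟩
  have hdisc : IsDiscrete (AddSubgroup.zmultiples (2 * Real.pi) : Set ℝ) :=
    ⟨inferInstanceAs (DiscreteTopology (AddSubgroup.zmultiples (2 * Real.pi)))⟩
  have hconst := isPreconnected_Icc.constant_of_mapsTo hdisc hgc hgT z1 z0
  have e1 : E 1 = e' := by funext i; simp [hE]
  have e0 : E 0 = e := by funext i; simp [hE]
  simp only [hg, e1, e0, hr, AffineMap.lineMap_apply_zero, Complex.arg_one, sub_self] at hconst
  have a1 := abs_lt.1 (abs_arg_lt_pi (hslit N le_rfl 1 z1))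
  have a2 := abs_lt.1 (abs_arg_lt_pi (hslit 0 N.zero_le 1 z1))
  rw [abs_lt]
  constructor <;> linarith

/-! ### Total turning of a path on the boundary of a convex set -/

lemma eq_mul_exp_totalTurning {e : ℕ → ℂ} {N : ℕ} (he : ∀ i ≤ N, e i ≠ 0) :
    ∃ ρ : ℝ, 0 < ρ ∧ e N = ρ * Complex.exp (totalTurning e N * Complex.I) * e 0 := by
  have h0 := he 0 N.zero_le
  have hN := he N le_rfl
  refine ⟨‖e N / e 0‖, norm_pos_iff.2 (div_ne_zero hN h0), ?_⟩
  have h := coe_totalTurning he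
  rw [← Complex.arg_div_coe_angle hN h0, Real.Angle.angle_eq_iff_two_pi_dvd_sub] at h
  obtain ⟨k, hk⟩ := h
  have : (totalTurning e N : ℂ) = Complex.arg (e N / e 0) + k * (2 * Real.pi) := by
    have : totalTurning e N = Complex.arg (e N / e 0) + k * (2 * Real.pi) := by linarith
    rw [this]; push_cast; ring
  rw [this, add_mul, Complex.exp_add,
    show (k * (2 * Real.pi) * Complex.I : ℂ) = k * (2 * Real.pi * Complex.I) by ring,
    Complex.exp_int_mul_two_pi_mul_I, mul_one, Complex.norm_mul_exp_arg_mul_I]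
  field_simp

/-- The cross product of two vectors of the plane. -/
def cross (a b : ℂ) : ℝ := a.re * b.im - a.im * b.re

/-- A path that has all its vertices on the left of (or on) the line through each of its edges
turns by at most `2π`. Otherwise, the vertex at which the total turning first exceeds `2π` and the
vertex at which it first becomes positive would both be the last point, in the direction of the
first edge, on the line through that edge. -/
lemma totalTurning_le_two_pi {z : ℕ → ℂ} {N : ℕ}
    (hl : ∀ i < N, ∀ j ≤ N, 0 ≤ cross (z (i + 1) - z i) (z j - z i))
    (hinj : ∀ i ≤ N, ∀ j ≤ N, z i = z j → i = j)
    (hs : ∀ i, i + 1 < N → (z (i + 2) - z (i + 1)) / (z (i + 1) - z i) ∈ Complex.slitPlane)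
    {n : ℕ} (hn : n < N) :
    0 ≤ totalTurning (fun i => z (i + 1) - z i) n ∧
    totalTurning (fun i => z (i + 1) - z i) n ≤ 2 * Real.pi := by
  set e : ℕ → ℂ := fun i => z (i + 1) - z i with he
  set φ : ℕ → ℝ := totalTurning e with hφ
  have he0 : ∀ i < N, e i ≠ 0 := fun i hi h => by
    have := hinj (i + 1) hi i hi.le (sub_eq_zero.1 h)
    omega
  -- each exterior angle lies in `[0, π)`
  have hθ : ∀ i, i + 1 < N → φ i ≤ φ (i + 1) ∧ φ (i + 1) < φ i + Real.pi := by
    intro i hi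
    have h1 : φ (i + 1) = φ i + Complex.arg (e (i + 1) / e i) := by
      simp only [hφ, totalTurning, Finset.sum_range_succ]
    have h2 := abs_lt.1 (abs_arg_lt_pi (hs i hi))
    have h3 : 0 ≤ Complex.arg (e (i + 1) / e i) := by
      rw [Complex.arg_nonneg_iff, Complex.div_im]
      have := hl i (by omega) (i + 2) (by omega)
      have hc : cross (z (i + 1) - z i) (z (i + 2) - z i) =
          (e (i + 1)).im * (e i).re - (e (i + 1)).re * (e i).im := by
        simp only [cross, he, Complex.sub_re, Complex.sub_im]; ring
      rw [hc] at this
      rw [← sub_div]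
      exact div_nonneg this (Complex.normSq_nonneg _)
    simp only [he] at h1 h2 h3 ⊢
    constructor <;> linarith [h2.2]
  have hφ0 : φ 0 = 0 := by simp [hφ, totalTurning]
  have hmono : ∀ i j, i ≤ j → j < N → φ i ≤ φ j := by
    intro i j hij
    induction j, hij using Nat.le_induction with
    | base => intro _; exact le_rfl
    | succ j _ ih => intro hj; exact (ih (by omega)).trans (hθ j hj).1
  refine ⟨hφ0 ▸ hmono 0 n n.zero_le hn, ?_⟩
  by_contra! hcon
  have hpi := Real.pi_pos
  -- the half-plane to the left of each edge, in coordinates adapted to the first edge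
  have hside : ∀ i < N, ∀ j ≤ N, 0 ≤ Real.cos (φ i) * ((z j - z i) / e 0).im
      - Real.sin (φ i) * ((z j - z i) / e 0).re := by
    intro i hi j hj
    obtain ⟨ρ, hρ, h⟩ := eq_mul_exp_totalTurning (e := e) (N := i) fun k hk => he0 k (by omega)
    have hc := hl i hi j hj
    set w := (z j - z i) / e 0 with hw
    have hzw : z j - z i = w * e 0 := by
      rw [hw, div_mul_cancel₀ _ (he0 0 (by omega))]
    have hei : z (i + 1) - z i = ρ * Complex.exp (φ i * Complex.I) * e 0 := h
    rw [hzw, hei, Complex.exp_mul_I, ← Complex.ofReal_cos, ← Complex.ofReal_sin] at hc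
    generalize Real.cos (φ i) = a at hc ⊢
    generalize Real.sin (φ i) = b at hc ⊢
    have hsq : cross (ρ * ((a : ℂ) + (b : ℂ) * Complex.I)
        * e 0) (w * e 0) =
        (ρ * Complex.normSq (e 0)) * (a * w.im - b * w.re) := by
      simp [cross, Complex.normSq_apply]
      ring
    rw [hsq] at hc
    have : 0 < ρ * Complex.normSq (e 0) :=
      mul_pos hρ (Complex.normSq_pos.2 (he0 0 (by omega)))
    exact nonneg_of_mul_nonneg_right hc this
  have hex : ∃ i, i < N ∧ 2 * Real.pi < φ i := ⟨n, hn, hcon⟩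
  classical
  obtain ⟨hiN, hi⟩ := Nat.find_spec hex
  have himin := fun k => Nat.find_min hex (m := k)
  generalize Nat.find hex = i at hiN hi himin
  obtain ⟨i', rfl⟩ : ∃ i', i = i' + 1 := Nat.exists_eq_succ_of_ne_zero (fun h => by
    rw [h, hφ0] at hi; linarith)
  have hi' : φ i' ≤ 2 * Real.pi := by
    by_contra! h
    exact himin i' (Nat.lt_succ_self _) ⟨by omega, h⟩
  have hex2 : ∃ j, j < N ∧ 0 < φ j := ⟨i' + 1, hiN, by linarith⟩
  obtain ⟨hjN, hj⟩ := Nat.find_spec hex2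
  have hjmin := fun k => Nat.find_min hex2 (m := k)
  generalize Nat.find hex2 = j at hjN hj hjmin
  obtain ⟨j', rfl⟩ : ∃ j', j = j' + 1 := Nat.exists_eq_succ_of_ne_zero (fun h => by
    rw [h, hφ0] at hj; linarith)
  have hj' : φ j' = 0 := by
    refine le_antisymm ?_ (hφ0 ▸ hmono 0 j' (Nat.zero_le _) (by omega))
    by_contra! h
    exact hjmin j' (Nat.lt_succ_self _) ⟨by omega, h⟩
  have hti := hθ i' hiN
  have htj := hθ j' hjN
  set w := (z (j' + 1) - z (i' + 1)) / e 0 with hw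
  -- differences based at the second end of an edge lie on the same side
  have hside' : ∀ k, k < N → ∀ l ≤ N, 0 ≤ Real.cos (φ k) * ((z l - z (k + 1)) / e 0).im
      - Real.sin (φ k) * ((z l - z (k + 1)) / e 0).re := by
    intro k hk l hl'
    obtain ⟨ρ, hρ, h⟩ := eq_mul_exp_totalTurning (e := e) (N := k) fun k hk => he0 k (by omega)
    have h1 := hside k hk l hl'
    have h2 : (z l - z k) / e 0 = (z l - z (k + 1)) / e 0
        + ρ * Complex.exp (φ k * Complex.I) := by
      have h3 : z l - z k = z l - z (k + 1) + e k := by simp only [he]; ring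
      rw [h3, add_div, h, mul_div_cancel_right₀ _ (he0 0 (by omega))]
    rw [h2, Complex.exp_mul_I, ← Complex.ofReal_cos, ← Complex.ofReal_sin] at h1
    simp only [Complex.add_im, Complex.add_re, Complex.mul_im, Complex.mul_re, Complex.ofReal_re,
      Complex.ofReal_im, Complex.I_re, Complex.I_im] at h1
    linarith
  have hneg : (z (i' + 1) - z (j' + 1)) / e 0 = -w := by rw [hw]; ring
  have c1 := hside' i' (by omega) (j' + 1) hjN.le
  have c2 := hside (i' + 1) hiN (j' + 1) hjN.le
  have c3 := hside' j' (by omega) (i' + 1) hiN.le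
  have c4 := hside (j' + 1) hjN (i' + 1) hiN.le
  rw [hneg, hj'] at c3
  rw [hneg] at c4
  simp only [← hw, Complex.neg_im, Complex.neg_re, Real.cos_zero, Real.sin_zero] at c1 c2 c3 c4
  rw [← Real.cos_sub_two_pi, ← Real.sin_sub_two_pi] at c1 c2
  have hα : -Real.pi < φ i' - 2 * Real.pi := by linarith
  have sα : Real.sin (φ i' - 2 * Real.pi) ≤ 0 :=
    Real.sin_nonpos_of_nonpos_of_neg_pi_le (by linarith) hα.le
  have sβ : 0 < Real.sin (φ (i' + 1) - 2 * Real.pi) :=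
    Real.sin_pos_of_pos_of_lt_pi (by linarith) (by linarith)
  have sj : 0 < Real.sin (φ (j' + 1)) := Real.sin_pos_of_pos_of_lt_pi hj (by linarith)
  have sαβ : 0 < Real.sin ((φ (i' + 1) - 2 * Real.pi) - (φ i' - 2 * Real.pi)) := by
    apply Real.sin_pos_of_pos_of_lt_pi <;> linarith
  rw [Real.sin_sub] at sαβ
  have him : w.im = 0 := by
    refine le_antisymm (by linarith) ?_
    have := add_nonneg (mul_nonneg sβ.le c1) (mul_nonneg (neg_nonneg.2 sα) c2)
    refine nonneg_of_mul_nonneg_right (b := w.im) ?_ sαβ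
    linarith
  have hre : w.re = 0 := by
    rw [him] at c2 c4
    apply le_antisymm
    · by_contra! h
      have := mul_pos sβ h
      linarith
    · by_contra! h
      have := mul_neg_of_pos_of_neg sj h
      linarith
  have hw0 : w = 0 := Complex.ext hre him
  rw [hw, div_eq_zero_iff, or_iff_left (he0 0 (by omega)), sub_eq_zero] at hw0
  have hij := hinj _ hjN.le _ hiN.le hw0
  have : φ (j' + 1) = φ (i' + 1) := by rw [hij]
  linarith

/-! ### Boundaries of plane convex bodies -/

section ConvexBody

variable {K : Set ℂ}

/-- A segment of a convex set that has an inner point outside the interior of the set lies on a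
supporting line. -/
lemma exists_supporting (hK : Convex ℝ K) (hi : (interior K).Nonempty) {a b x : ℂ}
    (ha : a ∈ K) (hb : b ∈ K) (hx : x ∈ openSegment ℝ a b) (hxK : x ∉ interior K) :
    ∃ f : ℂ →L[ℝ] ℝ, (∀ z ∈ interior K, f z < f a) ∧ (∀ z ∈ K, f z ≤ f a) ∧ f b = f a := by
  obtain ⟨f, hf⟩ := geometric_hahn_banach_open_point hK.interior isOpen_interior hxK
  have hle : ∀ z ∈ K, f z ≤ f x := by
    intro z hz
    have hz' : z ∈ closure (interior K) := by
      rw [hK.closure_interior_eq_closure_of_nonempty_interior hi]; exact subset_closure hz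
    exact closure_minimal (fun y hy => (hf y hy).le)
      (isClosed_le f.continuous continuous_const) hz'
  obtain ⟨s, t, hs, ht, hst, rfl⟩ := hx
  have h1 := hle a ha
  have h2 := hle b hb
  have h3 : f (s • a + t • b) = s * f a + t * f b := by
    rw [map_add, map_smul, map_smul, smul_eq_mul, smul_eq_mul]
  have hs' : s = 1 - t := by linarith
  rw [h3] at h1 h2
  subst hs'
  have h4 : f b = f a := by nlinarith
  have h5 : f ((1 - t) • a + t • b) = f a := by rw [h3, h4]; ring
  exact ⟨f, fun z hz => h5 ▸ hf z hz, fun z hz => h5 ▸ hle z hz, h4⟩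

lemma segment_subset_frontier (hK : Convex ℝ K) (hi : (interior K).Nonempty) {a b x : ℂ}
    (ha : a ∈ K) (hb : b ∈ K) (hx : x ∈ openSegment ℝ a b) (hxK : x ∈ frontier K) :
    segment ℝ a b ⊆ frontier K := by
  obtain ⟨f, h1, -, h3⟩ := exists_supporting hK hi ha hb hx hxK.2
  intro z hz
  refine ⟨subset_closure (hK.segment_subset ha hb hz), fun hzi => (h1 z hzi).ne ?_⟩
  obtain ⟨s, t, -, -, hst, rfl⟩ := hz
  have : f (s • a + t • b) = s * f a + t * f b := by
    rw [map_add, map_smul, map_smul, smul_eq_mul, smul_eq_mul]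
  rw [this, h3, ← add_mul, hst, one_mul]

lemma isPreconnected_sphere_diff_singleton {y : ℂ} (hy : y ∈ Metric.sphere (0 : ℂ) 1) :
    IsPreconnected (Metric.sphere (0 : ℂ) 1 \ {y}) := by
  have hy1 : ‖y‖ = 1 := by simpa using hy
  have hy0 : y ≠ 0 := norm_ne_zero_iff.1 (by rw [hy1]; exact one_ne_zero)
  have : Metric.sphere (0 : ℂ) 1 \ {y} =
      (fun t : ℝ => -y * Complex.exp (t * Complex.I)) '' Set.Ioo (-Real.pi) Real.pi := by
    ext x
    simp only [Set.mem_sdiff, mem_sphere_zero_iff_norm, Set.mem_singleton_iff, Set.mem_image]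
    constructor
    · rintro ⟨hx, hxy⟩
      have hx1 : ‖x / (-y)‖ = 1 := by rw [norm_div, norm_neg, hx, hy1, div_one]
      have h1 := Complex.norm_mul_exp_arg_mul_I (x / (-y))
      refine ⟨Complex.arg (x / (-y)), ⟨Complex.neg_pi_lt_arg _,
        (Complex.arg_le_pi _).lt_of_ne fun h => hxy ?_⟩, ?_⟩
      · rw [hx1, h, Complex.exp_pi_mul_I] at h1
        field_simp at h1
        simpa using h1.symm
      · rw [hx1, Complex.ofReal_one, one_mul] at h1
        rw [h1]
        field_simp
    · rintro ⟨t, ht, rfl⟩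
      refine ⟨by rw [norm_mul, norm_neg, hy1, Complex.norm_exp_ofReal_mul_I, one_mul], fun h => ?_⟩
      have h2 : Complex.exp (t * Complex.I) = -1 := by
        have : y * (Complex.exp (t * Complex.I) + 1) = 0 := by linear_combination -h
        exact eq_neg_of_add_eq_zero_left ((mul_eq_zero.1 this).resolve_left hy0)
      have h3 := Complex.arg_exp_mul_I t
      rw [h2, Complex.arg_neg_one, (toIocMod_eq_self Real.two_pi_pos).2
        ⟨ht.1, by linarith [ht.2, Real.pi_pos]⟩] at h3
      exact ht.2.ne h3.symm
  rw [this]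
  exact isPreconnected_Ioo.image _ (by fun_prop)

/-- The boundary of a plane convex body is homeomorphic to a circle. -/
lemma exists_homeomorph_frontier_sphere (hK : Convex ℝ K) (hi : (interior K).Nonempty)
    (hb : Bornology.IsBounded K) :
    ∃ h : ℂ ≃ₜ ℂ, h '' frontier K = Metric.sphere (0 : ℂ) 1 := by
  obtain ⟨e, -, -, he⟩ := exists_homeomorph_image_eq hK hi
    ((NormedSpace.isVonNBounded_iff ℝ).2 hb) (convex_closedBall (0 : ℂ) 1)
    (by rw [interior_closedBall _ one_ne_zero]; exact ⟨0, by simp⟩)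
    ((NormedSpace.isVonNBounded_iff ℝ).2 Metric.isBounded_closedBall)
  exact ⟨e, by rw [he, frontier_closedBall _ one_ne_zero]⟩

lemma isPreconnected_frontier_diff_singleton (hK : Convex ℝ K) (hi : (interior K).Nonempty)
    (hb : Bornology.IsBounded K) {x : ℂ} (hx : x ∈ frontier K) :
    IsPreconnected (frontier K \ {x}) := by
  obtain ⟨h, hh⟩ := exists_homeomorph_frontier_sphere hK hi hb
  rw [← h.isPreconnected_image, Set.image_sdiff h.injective, hh, Set.image_singleton]
  exact isPreconnected_sphere_diff_singleton (hh ▸ Set.mem_image_of_mem h hx)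

lemma infinite_frontier (hK : Convex ℝ K) (hi : (interior K).Nonempty)
    (hb : Bornology.IsBounded K) : (frontier K).Infinite := by
  obtain ⟨h, hh⟩ := exists_homeomorph_frontier_sphere hK hi hb
  refine Set.Infinite.of_image h ?_
  rw [hh]
  refine (isPreconnected_sphere (by simp) _ _).infinite_of_nontrivial ⟨1, by simp, -1, by simp, ?_⟩
  norm_num

end ConvexBody

/-! ### The outer face -/

variable {V : Type*} {G : SimpleGraph V} {p : V → ℂ}

lemma vertex_mem_drawingSet (v : V) : p v ∈ drawingSet G p := Or.inl ⟨v, rfl⟩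

lemma isCompact_drawingSet [Finite V] : IsCompact (drawingSet G p) := by
  have : drawingSet G p =
      Set.range p ∪ ⋃ e : {e : V × V // G.Adj e.1 e.2}, segment ℝ (p e.1.1) (p e.1.2) := by
    ext z
    simp [drawingSet, eq_comm]
  rw [this]
  refine (Set.finite_range p).isCompact.union (isCompact_iUnion fun e => ?_)
  rw [segment_eq_image_lineMap]
  exact isCompact_Icc.image AffineMap.lineMap_continuous

lemma isPreconnected_setOf_lt_norm (R : ℝ) :
    IsPreconnected {z : ℂ | R < ‖z‖} := by
  have : {z : ℂ | R < ‖z‖} = (fun x : ℝ × ℝ => (x.1 : ℂ) * Complex.exp (x.2 * Complex.I)) ''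
      (Set.Ioi R ×ˢ Set.univ) := by
    ext z
    constructor
    · intro hz
      exact ⟨(‖z‖, Complex.arg z), ⟨hz, trivial⟩, Complex.norm_mul_exp_arg_mul_I z⟩
    · rintro ⟨⟨r, t⟩, ⟨hr, -⟩, rfl⟩
      have hr : R < r := hr
      simp only [Set.mem_ofPred_eq, norm_mul, Complex.norm_real, Complex.norm_exp_ofReal_mul_I,
        mul_one]
      exact hr.trans_le (le_abs_self r)
  rw [this]
  exact (isPreconnected_Ioi.prod isPreconnected_univ).image _ (by fun_prop)

lemma drawingSet_subset_compl_face {F : Set ℂ} (hF : F ∈ faces G p) : drawingSet G p ⊆ Fᶜ := by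
  obtain ⟨z, -, rfl⟩ := hF
  exact fun x hx hxF => connectedComponentIn_subset _ _ hxF hx

lemma isOpen_of_mem_faces [Finite V] {F : Set ℂ} (hF : F ∈ faces G p) : IsOpen F := by
  obtain ⟨z, -, rfl⟩ := hF
  exact isCompact_drawingSet.isClosed.isOpen_compl.connectedComponentIn

lemma frontier_subset_drawingSet [Finite V] {F : Set ℂ} (hF : F ∈ faces G p) :
    frontier F ⊆ drawingSet G p := by
  have ho := isOpen_of_mem_faces hF
  obtain ⟨z, hz, rfl⟩ := hF
  intro x hx
  rw [ho.frontier_eq] at hx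
  by_contra hxD
  have hzF := mem_connectedComponentIn hz
  refine hx.2 ((IsPreconnected.subset_connectedComponentIn (s := insert x
    (connectedComponentIn (drawingSet G p)ᶜ z)) ?_ (Set.mem_insert_of_mem _ hzF) ?_)
      (Set.mem_insert _ _))
  · exact isPreconnected_connectedComponentIn.subset_closure (Set.subset_insert _ _)
      (Set.insert_subset hx.1 subset_closure)
  · exact Set.insert_subset hxD (connectedComponentIn_subset _ _)

lemma exists_outer_face [Finite V] (G : SimpleGraph V) (p : V → ℂ) :
    ∃ F ∈ faces G p, ¬ Bornology.IsBounded F ∧ Bornology.IsBounded Fᶜ := by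
  obtain ⟨R, hR⟩ := (isCompact_drawingSet (G := G) (p := p)).isBounded.subset_closedBall 0
  have hsub : {z : ℂ | R < ‖z‖} ⊆ (drawingSet G p)ᶜ := by
    intro z hz hzD
    have := hR hzD
    simp only [mem_closedBall_zero_iff] at this
    exact absurd hz (not_lt.2 this)
  have hz : ((R + 1 : ℝ) : ℂ) ∈ {z : ℂ | R < ‖z‖} := by
    simp only [Set.mem_ofPred_eq, Complex.norm_real]
    exact (lt_add_one R).trans_le (le_abs_self _)
  have hF := (isPreconnected_setOf_lt_norm R).subset_connectedComponentIn hz hsub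
  have hFb : Bornology.IsBounded
      (connectedComponentIn (drawingSet G p)ᶜ ((R + 1 : ℝ) : ℂ))ᶜ := by
    refine (Metric.isBounded_closedBall (x := (0 : ℂ)) (r := R)).subset ?_
    intro x hx
    by_contra h
    exact hx (hF (by simpa using h))
  refine ⟨_, ⟨_, hsub hz, rfl⟩, fun h => ?_, hFb⟩
  have := h.union hFb
  rw [Set.union_compl_self] at this
  exact NormedSpace.unbounded_univ ℝ ℂ this

/-- A planar drawing does not fold back at a vertex. -/
lemma IsPlanarDrawing.div_mem_slitPlane (hp : IsPlanarDrawing G p) {a b c : V}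
    (hab : G.Adj a b) (hbc : G.Adj b c) (hac : a ≠ c) :
    (p c - p b) / (p b - p a) ∈ Complex.slitPlane := by
  have h1 : p b - p a ≠ 0 := sub_ne_zero.2 fun h => hab.ne (hp.injective h.symm)
  by_contra h
  rw [Complex.mem_slitPlane_iff] at h
  push Not at h
  set w := (p c - p b) / (p b - p a) with hw
  have h2 : p c = AffineMap.lineMap (p b) (p a) (-w.re) := by
    have h3 : p c - p b = w * (p b - p a) := by rw [hw, div_mul_cancel₀ _ h1]
    have h4 : w = (w.re : ℂ) := Complex.ext rfl (by simpa using h.2)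
    rw [AffineMap.lineMap_apply_module', Complex.real_smul]
    rw [h4] at h3
    push_cast
    linear_combination h3
  rcases le_total (-w.re) 1 with h5 | h5
  · rcases hp.vertex_edge b a c hab.symm (by
      rw [segment_eq_image_lineMap]; exact ⟨_, ⟨by linarith [h.1], h5⟩, h2.symm⟩) with h6 | h6
    · exact hbc.ne h6.symm
    · exact hac h6.symm
  · have h0 : (-w.re : ℝ) ≠ 0 := by linarith
    have h6 : p a = AffineMap.lineMap (p b) (p c) (1 / (-w.re)) := by
      rw [h2, AffineMap.lineMap_apply_module', AffineMap.lineMap_apply_module', add_sub_cancel_right,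
        smul_smul, one_div_mul_cancel h0, one_smul]
      ring
    rcases hp.vertex_edge b c a hbc (by
      rw [segment_eq_image_lineMap]
      exact ⟨_, ⟨by positivity, by rw [div_le_one (by linarith)]; exact h5⟩, h6.symm⟩) with h7 | h7
    · exact hab.ne h7
    · exact hac h7

/-! ### Convex drawings of a cycle -/

/-- If the boundary of a convex body that contains the drawing is covered by the drawing, then it
cannot end at a vertex `v` of degree two: with one of the two edges at `v` it contains the other
one. Otherwise the removal of one inner point of the former edge would disconnect the boundary. -/
lemma next_segment_subset_frontier [Finite V] {K : Set ℂ} (hK : Convex ℝ K)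
    (hi : (interior K).Nonempty) (hb : Bornology.IsBounded K) (hp : IsPlanarDrawing G p)
    (hDK : drawingSet G p ⊆ K) (hKD : frontier K ⊆ drawingSet G p) {u v w : V}
    (huv : G.Adj v u) (hvw : G.Adj v w) (hdeg : ∀ b, G.Adj v b → b = u ∨ b = w)
    (hfull : segment ℝ (p v) (p u) ⊆ frontier K) : segment ℝ (p v) (p w) ⊆ frontier K := by
  by_cases hx : ∃ x ∈ openSegment ℝ (p v) (p w), x ∈ frontier K
  · obtain ⟨x, hx, hxK⟩ := hx
    exact segment_subset_frontier hK hi (hDK (vertex_mem_drawingSet v))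
      (hDK (vertex_mem_drawingSet w)) hx hxK
  exfalso
  push Not at hx
  have hne : p v ≠ p u := fun h => huv.ne (hp.injective h)
  set L : ℝ → ℂ := fun t => AffineMap.lineMap (p v) (p u) t with hL
  have hLc : Continuous L := AffineMap.lineMap_continuous
  have hLinj : Function.Injective L := AffineMap.lineMap_injective ℝ hne
  have hseg : segment ℝ (p v) (p u) = L '' Set.Icc 0 1 := segment_eq_image_lineMap ..
  have hL0 : L 0 = p v := by simp [hL]
  have hL1 : L 1 = p u := by simp [hL]
  set C₁ : Set ℂ := L '' Set.Icc 0 (1 / 2) with hC₁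
  set C₂ : Set ℂ := L '' Set.Icc (1 / 2) 1 ∪ ((p '' {v}ᶜ) ∪
    ⋃ e : {e : V × V // G.Adj e.1 e.2 ∧ e.1 ≠ v ∧ e.2 ≠ v}, segment ℝ (p e.1.1) (p e.1.2)) with hC₂
  have hLv : p v ∈ frontier K \ {L (1 / 2)} := by
    refine ⟨hfull (left_mem_segment ..), fun h => ?_⟩
    have := hLinj (hL0.trans h)
    norm_num at this
  have hLu : p u ∈ frontier K \ {L (1 / 2)} := by
    refine ⟨hfull (right_mem_segment ..), fun h => ?_⟩
    have := hLinj (hL1.trans h)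
    norm_num at this
  have hmid : L (1 / 2) ∈ frontier K := hfull (hseg ▸ ⟨1 / 2, by norm_num, rfl⟩)
  have hcl₁ : IsClosed C₁ := (isCompact_Icc.image hLc).isClosed
  have hcl₂ : IsClosed C₂ := by
    refine (isCompact_Icc.image hLc).isClosed.union ((Set.toFinite _).isClosed.union ?_)
    refine isClosed_iUnion_of_finite fun e => ?_
    rw [segment_eq_image_lineMap]
    exact (isCompact_Icc.image AffineMap.lineMap_continuous).isClosed
  have hcov : frontier K \ {L (1 / 2)} ⊆ C₁ ∪ C₂ := by
    -- an edge at `v` contributes to the boundary only if it is the edge to `u`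
    have hstar : ∀ b, G.Adj v b → ∀ z ∈ segment ℝ (p v) (p b), z ∈ frontier K → z ∈ C₁ ∪ C₂ := by
      intro b hb z hz hzK
      rcases hdeg b hb with rfl | rfl
      · rw [hseg] at hz
        obtain ⟨t, ht, rfl⟩ := hz
        rcases le_total t (1 / 2) with h | h
        · exact Or.inl ⟨t, ⟨ht.1, h⟩, rfl⟩
        · exact Or.inr (Or.inl ⟨t, ⟨h, ht.2⟩, rfl⟩)
      · by_cases h1 : z = p v
        · exact Or.inl ⟨0, by norm_num, by rw [hL0, h1]⟩
        by_cases h2 : z = p b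
        · exact Or.inr (Or.inr (Or.inl ⟨b, hb.ne', h2.symm⟩))
        · exact absurd hzK (hx z (mem_openSegment_of_ne_left_right (Ne.symm h1) (Ne.symm h2) hz))
    rintro z ⟨hzK, -⟩
    rcases hKD hzK with ⟨a, rfl⟩ | ⟨a, b, hab, hz⟩
    · by_cases ha : a = v
      · subst ha
        exact Or.inl ⟨0, by norm_num, hL0⟩
      · exact Or.inr (Or.inr (Or.inl ⟨a, ha, rfl⟩))
    · by_cases ha : a = v
      · subst ha
        exact hstar b hab z hz hzK
      by_cases hb : b = v
      · subst hb
        exact hstar a hab.symm z (segment_symm ℝ (p a) (p b) ▸ hz) hzK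
      · exact Or.inr (Or.inr (Or.inr (Set.mem_iUnion.2 ⟨⟨(a, b), hab, ha, hb⟩, hz⟩)))
  obtain ⟨z, ⟨hzK, hzm⟩, hz₁, hz₂⟩ := isPreconnected_closed_iff.1
    (isPreconnected_frontier_diff_singleton hK hi hb hmid) C₁ C₂ hcl₁ hcl₂ hcov
    ⟨p v, hLv, 0, by norm_num, hL0⟩ ⟨p u, hLu, Or.inl ⟨1, by norm_num, hL1⟩⟩
  obtain ⟨t, ht, rfl⟩ := hz₁
  have ht' : t < 1 / 2 := ht.2.lt_of_ne fun h => hzm (by rw [h]; rfl)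
  have hzs : L t ∈ segment ℝ (p v) (p u) := hseg ▸ ⟨t, ⟨ht.1, by linarith⟩, rfl⟩
  have hzu : L t ≠ p u := fun h => by
    have := hLinj (h.trans hL1.symm)
    linarith
  rcases hz₂ with ⟨s, hs, hst⟩ | ⟨a, ha, hza⟩ | hz
  · have := hLinj hst
    linarith [hs.1]
  · rcases hp.vertex_edge v u a huv (hza ▸ hzs) with h | h
    · exact ha h
    · exact hzu (by rw [← hza, h])
  · obtain ⟨⟨⟨a, b⟩, hab, ha, hb⟩, hz⟩ := Set.mem_iUnion.1 hz
    simp only at hab ha hb hz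
    by_cases h1 : L t = p v
    · rcases hp.vertex_edge a b v hab (h1 ▸ hz) with h | h
      · exact ha h.symm
      · exact hb h.symm
    have hvert : ∀ c, c ≠ v → L t ≠ p c := by
      intro c hc h
      rcases hp.vertex_edge v u c huv (h ▸ hzs) with h' | h'
      · exact hc h'
      · exact hzu (h' ▸ h)
    refine Set.disjoint_left.1 (hp.edge_edge v u a b huv hab ?_)
      (mem_openSegment_of_ne_left_right (Ne.symm h1) (Ne.symm hzu) hzs)
      (mem_openSegment_of_ne_left_right (hvert a ha).symm (hvert b hb).symm hz)
    intro h
    have : v ∈ s(a, b) := h ▸ Sym2.mem_mk_left v u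
    rcases Sym2.mem_iff.1 this with h | h
    · exact ha h.symm
    · exact hb h.symm

lemma cross_mul_cross_nonneg {K : Set ℂ} (hK : Convex ℝ K) {a b c : ℂ}
    (hc : c ∈ interior K) (hab : a ≠ b) (ha : a ∈ K) (hb : b ∈ K)
    (h : segment ℝ a b ⊆ frontier K) :
    cross (b - a) (c - a) ≠ 0 ∧ ∀ z ∈ K, 0 ≤ cross (b - a) (z - a) * cross (b - a) (c - a) := by
  have hmid : midpoint ℝ a b ∈ openSegment ℝ a b := by
    refine mem_openSegment_of_ne_left_right ?_ ?_ (midpoint_mem_segment a b)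
    · simpa [left_eq_midpoint_iff] using hab
    · simpa [right_eq_midpoint_iff] using hab
  obtain ⟨f, hf1, hf2, hf3⟩ := exists_supporting hK ⟨c, hc⟩ ha hb hmid
    (h (midpoint_mem_segment a b)).2
  set e := b - a with he
  have he0 : e ≠ 0 := sub_ne_zero.2 hab.symm
  have hfe : f e = 0 := by rw [he, map_sub, hf3, sub_self]
  have key : ∀ w, f w * Complex.normSq e = cross e w * f (Complex.I * e) := by
    intro w
    have : (Complex.normSq e) • w =
        (w.re * e.re + w.im * e.im) • e + cross e w • (Complex.I * e) := by
      apply Complex.ext <;> simp [cross, Complex.normSq_apply] <;> ring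
    have := congrArg f this
    rw [map_add, map_smul, map_smul, map_smul, hfe, smul_zero, zero_add] at this
    rw [mul_comm]
    exact this
  have hN : 0 < Complex.normSq e := Complex.normSq_pos.2 he0
  have hcneg : f (c - a) < 0 := by rw [map_sub]; linarith [hf1 c hc]
  have kc := key (c - a)
  have hIe : f (Complex.I * e) ≠ 0 := fun h0 => by
    rw [h0, mul_zero] at kc
    exact (mul_neg_of_neg_of_pos hcneg hN).ne kc
  refine ⟨fun h0 => ?_, fun z hz => ?_⟩
  · rw [h0, zero_mul] at kc
    exact (mul_neg_of_neg_of_pos hcneg hN).ne kc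
  · have kz := key (z - a)
    have hz' : f (z - a) ≤ 0 := by rw [map_sub]; linarith [hf2 z hz]
    have hprod : cross e (z - a) * cross e (c - a) * f (Complex.I * e) ^ 2 =
        (f (z - a) * f (c - a)) * Complex.normSq e ^ 2 := by
      linear_combination -(cross e (c - a) * f (Complex.I * e)) * kz
        - (f (z - a) * Complex.normSq e) * kc
    have h2 : 0 ≤ cross e (z - a) * cross e (c - a) * f (Complex.I * e) ^ 2 := by
      rw [hprod]
      exact mul_nonneg (mul_nonneg_of_nonpos_of_nonpos hz' hcneg.le) (by positivity)
    exact nonneg_of_mul_nonneg_left h2 (by positivity)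

/-! ### Total turning of drawings of a cycle -/

section Cycle

variable {n : ℕ}

/-- The vertices of a drawing of a cycle, read cyclically from the vertex `0` on. -/
def cyclePoint [NeZero n] (p : Fin n → ℂ) (i : ℕ) : ℂ := p (Fin.ofNat n i)

/-- The edge vectors of a drawing of a cycle, read cyclically. -/
def cycleEdge [NeZero n] (p : Fin n → ℂ) (i : ℕ) : ℂ := cyclePoint p (i + 1) - cyclePoint p i

lemma ofNat_succ (i : ℕ) : Fin.ofNat (n + 2) (i + 1) = Fin.ofNat (n + 2) i + 1 := by
  ext
  simp [Fin.val_add]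

lemma cycleGraph_adj_ofNat (i : ℕ) :
    (SimpleGraph.cycleGraph (n + 2)).Adj (Fin.ofNat (n + 2) i) (Fin.ofNat (n + 2) (i + 1)) := by
  rw [SimpleGraph.cycleGraph_adj, ofNat_succ]
  right
  abel

lemma ofNat_injOn [NeZero n] {i j : ℕ} (hi : i < n) (hj : j < n)
    (h : Fin.ofNat n i = Fin.ofNat n j) : i = j := by
  simpa [Fin.ext_iff, Nat.mod_eq_of_lt hi, Nat.mod_eq_of_lt hj] using h

lemma ofNat_ne_ofNat_add_two (i : ℕ) :
    Fin.ofNat (n + 3) i ≠ Fin.ofNat (n + 3) (i + 2) := by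
  rw [show i + 2 = (i + 1) + 1 from rfl, ofNat_succ, ofNat_succ, add_assoc]
  intro h
  have h2 : (1 + 1 : Fin (n + 3)) = 0 := by simpa using h.symm
  have := congrArg Fin.val h2
  simp only [Fin.val_add, Fin.val_one, Fin.val_zero] at this
  rw [Nat.mod_eq_of_lt (by omega)] at this
  omega

lemma neighbors_ofNat_succ {i : ℕ} {b : Fin (n + 2)}
    (h : (SimpleGraph.cycleGraph (n + 2)).Adj (Fin.ofNat (n + 2) (i + 1)) b) :
    b = Fin.ofNat (n + 2) i ∨ b = Fin.ofNat (n + 2) (i + 2) := by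
  rw [show i + 2 = (i + 1) + 1 from rfl, ofNat_succ (i + 1)]
  rw [SimpleGraph.cycleGraph_adj] at h
  rcases h with h | h
  · left
    rw [ofNat_succ] at h
    rw [sub_eq_iff_eq_add, add_comm (1 : Fin (n + 2))] at h
    exact (add_right_cancel h).symm
  · right
    rw [← h]; abel

lemma cycleEdge_div_mem_slitPlane {p : Fin (n + 3) → ℂ}
    (hp : IsPlanarDrawing (SimpleGraph.cycleGraph (n + 3)) p) (i : ℕ) :
    cycleEdge p (i + 1) / cycleEdge p i ∈ Complex.slitPlane :=
  hp.div_mem_slitPlane (cycleGraph_adj_ofNat i) (cycleGraph_adj_ofNat (i + 1))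
    (ofNat_ne_ofNat_add_two i)

lemma cycleEdge_ne_zero {p : Fin (n + 3) → ℂ}
    (hp : IsPlanarDrawing (SimpleGraph.cycleGraph (n + 3)) p) (i : ℕ) : cycleEdge p i ≠ 0 :=
  sub_ne_zero.2 fun h => (cycleGraph_adj_ofNat i).ne (hp.injective h.symm)

/-- In a convex drawing of a cycle, every edge lies on the boundary of a convex body that contains
the drawing. -/
lemma IsConvexDrawing.exists_convex_body {p : Fin (n + 3) → ℂ}
    (hp : IsConvexDrawing (SimpleGraph.cycleGraph (n + 3)) p) :
    ∃ K : Set ℂ, Convex ℝ K ∧ (interior K).Nonempty ∧ (∀ i, cyclePoint p i ∈ K) ∧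
      ∀ i, segment ℝ (cyclePoint p i) (cyclePoint p (i + 1)) ⊆ frontier K := by
  obtain ⟨F, hF, hFu, hFb⟩ := exists_outer_face (SimpleGraph.cycleGraph (n + 3)) p
  obtain ⟨hK, hi⟩ := hp.outer F hF hFu
  have hDK := drawingSet_subset_compl_face hF
  have hKD : frontier Fᶜ ⊆ drawingSet _ p := frontier_compl F ▸ frontier_subset_drawingSet hF
  refine ⟨Fᶜ, hK, hi, fun i => hDK (vertex_mem_drawingSet _), ?_⟩
  have hstep : ∀ i, segment ℝ (cyclePoint p i) (cyclePoint p (i + 1)) ⊆ frontier Fᶜ →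
      segment ℝ (cyclePoint p (i + 1)) (cyclePoint p (i + 2)) ⊆ frontier Fᶜ := by
    intro i h
    rw [segment_symm] at h
    exact next_segment_subset_frontier hK hi hFb hp.planar hDK hKD (cycleGraph_adj_ofNat i).symm
      (cycleGraph_adj_ofNat (i + 1)) (fun b hb => neighbors_ofNat_succ hb) h
  -- the boundary is infinite, hence contains an inner point of some edge
  obtain ⟨i₀, h₀⟩ : ∃ i, segment ℝ (cyclePoint p i) (cyclePoint p (i + 1)) ⊆ frontier Fᶜ := by
    obtain ⟨x, hx, hxv⟩ := ((infinite_frontier hK hi hFb).sdiff (Set.finite_range p)).nonempty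
    rcases hKD hx with ⟨v, rfl⟩ | ⟨u, v, huv, hz⟩
    · exact absurd ⟨v, rfl⟩ hxv
    have hfull := segment_subset_frontier hK hi (hDK (vertex_mem_drawingSet u))
      (hDK (vertex_mem_drawingSet v)) (mem_openSegment_of_ne_left_right
        (fun h => hxv ⟨u, h⟩) (fun h => hxv ⟨v, h⟩) hz) hx
    have hof : ∀ v : Fin (n + 3), Fin.ofNat (n + 3) v.val = v := fun v => by ext; simp
    rcases SimpleGraph.cycleGraph_adj.1 huv with h | h
    · refine ⟨v.val, ?_⟩
      rw [segment_symm, cyclePoint, cyclePoint, ofNat_succ, hof, ← h, add_sub_cancel]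
      exact hfull
    · refine ⟨u.val, ?_⟩
      rw [cyclePoint, cyclePoint, ofNat_succ, hof, ← h, add_sub_cancel]
      exact hfull
  have hall : ∀ j, segment ℝ (cyclePoint p (i₀ + j)) (cyclePoint p (i₀ + j + 1))
      ⊆ frontier Fᶜ := by
    intro j
    induction j with
    | zero => exact h₀
    | succ j ih => exact hstep _ ih
  intro i
  have hper : ∀ i, cyclePoint p (i + (n + 3) * i₀) = cyclePoint p i := fun i => by
    unfold cyclePoint
    congr 1
    ext
    simp
  have h := hall (i + (n + 2) * i₀)
  rw [show i₀ + (i + (n + 2) * i₀) = i + (n + 3) * i₀ by ring,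
    show i + (n + 3) * i₀ + 1 = (i + 1) + (n + 3) * i₀ by ring, hper, hper] at h
  exact h

lemma cross_ofReal_mul_left (r : ℝ) (a b : ℂ) : cross (r * a) b = r * cross a b := by
  simp [cross]
  ring

lemma cross_conj (a b : ℂ) :
    cross ((starRingEnd ℂ) a) ((starRingEnd ℂ) b) = -cross a b := by
  simp [cross]
  ring

/-- In a convex drawing of a cycle, no path turns by more than `2π`. -/
theorem IsConvexDrawing.abs_totalTurning_le {p : Fin (n + 3) → ℂ}
    (hp : IsConvexDrawing (SimpleGraph.cycleGraph (n + 3)) p) {N : ℕ} (hN : N < n + 2) :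
    |totalTurning (cycleEdge p) N| ≤ 2 * Real.pi := by
  obtain ⟨K, hK, ⟨c, hc⟩, hzK, hseg⟩ := hp.exists_convex_body
  set z := cyclePoint p with hz
  have hinj : ∀ i ≤ n + 2, ∀ j ≤ n + 2, z i = z j → i = j := fun i hi j hj h =>
    ofNat_injOn (by omega) (by omega) (hp.planar.injective h)
  have hslit : ∀ i, (z (i + 2) - z (i + 1)) / (z (i + 1) - z i) ∈ Complex.slitPlane :=
    cycleEdge_div_mem_slitPlane hp.planar
  have hne : ∀ i, z i ≠ z (i + 1) := fun i =>
    (sub_ne_zero.1 (cycleEdge_ne_zero hp.planar i)).symm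
  have hcr := fun i => cross_mul_cross_nonneg hK hc (hne i) (hzK i) (hzK (i + 1)) (hseg i)
  set A : ℕ → ℝ := fun i => cross (z (i + 1) - z i) (c - z i) with hA
  -- the body lies on the same side of consecutive edges
  have hstep : ∀ i, 0 < A i * A (i + 1) := by
    intro i
    by_contra! hcon
    have hlt : A i * A (i + 1) < 0 :=
      lt_of_le_of_ne hcon (mul_ne_zero (hcr i).1 (hcr (i + 1)).1)
    set X := cross (z (i + 1) - z i) (z (i + 2) - z (i + 1)) with hX
    have h1 : 0 ≤ X * A i := by
      have := (hcr i).2 _ (hzK (i + 2))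
      have e : cross (z (i + 1) - z i) (z (i + 2) - z i) = X := by
        simp [hX, cross]; ring
      rwa [e] at this
    have h2 : 0 ≤ X * A (i + 1) := by
      have := (hcr (i + 1)).2 _ (hzK i)
      have e : cross (z (i + 1 + 1) - z (i + 1)) (z i - z (i + 1)) = X := by
        simp [hX, cross]; ring
      rwa [e] at this
    have hX0 : X = 0 := by
      by_contra h0
      have := mul_nonneg h1 h2
      have h3 : 0 < X ^ 2 := by positivity
      nlinarith
    have hs := hslit i
    set w := (z (i + 2) - z (i + 1)) / (z (i + 1) - z i) with hw
    have hz0 : z (i + 1) - z i ≠ 0 := sub_ne_zero.2 (hne i).symm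
    have hwm : z (i + 2) - z (i + 1) = w * (z (i + 1) - z i) := by
      rw [hw, div_mul_cancel₀ _ hz0]
    have him : w.im = 0 := by
      have e : X = w.im * Complex.normSq (z (i + 1) - z i) := by
        rw [hX, hwm]
        simp only [cross, Complex.mul_re, Complex.mul_im, Complex.normSq_apply]
        ring
      rw [hX0] at e
      exact (mul_eq_zero.1 e.symm).resolve_right (Complex.normSq_pos.2 hz0).ne'
    have hre : 0 < w.re := by
      rcases Complex.mem_slitPlane_iff.1 hs with h | h
      · exact h
      · exact absurd him h
    have hwr : w = (w.re : ℂ) := Complex.ext rfl (by simpa using him)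
    have hAA : A (i + 1) = w.re * A i := by
      simp only [hA]
      rw [show i + 1 + 1 = i + 2 from rfl, hwm]
      nth_rw 1 [hwr]
      rw [cross_ofReal_mul_left]
      simp [cross]
      left
      ring
    rw [hAA] at hlt
    nlinarith [mul_nonneg hre.le (mul_self_nonneg (A i))]
  have hsign : ∀ i, 0 < A 0 * A i := by
    intro i
    induction i with
    | zero => exact mul_self_pos.2 (hcr 0).1
    | succ i ih =>
      have h3 : 0 < (A 0 * A (i + 1)) * (A i) ^ 2 := by
        have := mul_pos ih (hstep i)
        linarith
      exact pos_of_mul_pos_left h3 (by positivity)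
  rcases lt_or_gt_of_ne (hcr 0).1 with h0 | h0
  · -- clockwise orientation: pass to the mirror image
    have hAneg : ∀ i, A i < 0 := fun i => neg_of_mul_pos_right (hsign i) (le_of_lt h0)
    have h := totalTurning_le_two_pi (z := fun i => (starRingEnd ℂ) (z i)) (N := n + 2)
      (fun i _ j _ => by
        simp only [← map_sub]
        rw [cross_conj]
        have := (hcr i).2 _ (hzK j)
        have hle : cross (z (i + 1) - z i) (z j - z i) ≤ 0 :=
          nonpos_of_mul_nonneg_left this (hAneg i)
        linarith)
      (fun i hi j hj hij => hinj i hi j hj ((starRingEnd ℂ).injective hij))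
      (fun i _ => by
        have h := hslit i
        simp only [← map_sub, ← map_div₀]
        rw [Complex.mem_slitPlane_iff] at h ⊢
        rwa [Complex.conj_re, Complex.conj_im, neg_ne_zero]) hN
    have hconj := totalTurning_conj (e := cycleEdge p) (N := N) fun i _ => hslit i
    have heq : (fun i => (starRingEnd ℂ) (z (i + 1)) - (starRingEnd ℂ) (z i)) =
        fun i => (starRingEnd ℂ) (cycleEdge p i) := by
      funext i; rw [← map_sub]; rfl
    rw [heq, hconj] at h
    rw [abs_le]
    constructor <;> linarith [h.1, h.2]
  · have hApos : ∀ i, 0 < A i := fun i => pos_of_mul_pos_right (hsign i) (le_of_lt h0)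
    have h := totalTurning_le_two_pi (z := z) (N := n + 2)
      (fun i _ j _ => nonneg_of_mul_nonneg_left ((hcr i).2 _ (hzK j)) (hApos i))
      hinj (fun i _ => hslit i) hN
    have h : 0 ≤ totalTurning (cycleEdge p) N ∧ totalTurning (cycleEdge p) N ≤ 2 * Real.pi := h
    rw [abs_le]
    constructor <;> linarith [h.1, h.2, Real.pi_pos]

lemma cycleEdge_linearMorph (p q : Fin (n + 3) → ℂ) (t : ℝ) (i : ℕ) :
    cycleEdge (linearMorph p q t) i = AffineMap.lineMap (cycleEdge p i) (cycleEdge q i) t := by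
  simp only [cycleEdge, cyclePoint, linearMorph, AffineMap.lineMap_apply_module]
  module

/-- A planar linear morph changes the total turning of a path by less than `2π`. -/
lemma IsPlanarLinearMorph.abs_totalTurning_sub_lt {p q : Fin (n + 3) → ℂ}
    (h : IsPlanarLinearMorph (SimpleGraph.cycleGraph (n + 3)) p q) (N : ℕ) :
    |totalTurning (cycleEdge q) N - totalTurning (cycleEdge p) N| < 2 * Real.pi := by
  refine PlaneDrawing.abs_totalTurning_sub_lt (fun t ht i _ => ?_) (fun t ht i _ => ?_)
  · rw [← cycleEdge_linearMorph]
    exact cycleEdge_ne_zero (h t ht) i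
  · rw [← cycleEdge_linearMorph, ← cycleEdge_linearMorph]
    exact cycleEdge_div_mem_slitPlane (h t ht) i

/-- The number of linear steps of a convexifying morph is at least the initial number of full turns
of any path, minus one. -/
theorem IsConvexifyingMorph.totalTurning_le {p : Fin (n + 3) → ℂ} {k : ℕ}
    {Δ : ℕ → Fin (n + 3) → ℂ}
    (h : IsConvexifyingMorph (SimpleGraph.cycleGraph (n + 3)) p k Δ) {N : ℕ} (hN : N < n + 2) :
    totalTurning (cycleEdge p) N ≤ 2 * Real.pi * (k + 1) := by
  have hsteps : ∀ i ≤ k, totalTurning (cycleEdge p) N - totalTurning (cycleEdge (Δ i)) N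
      ≤ 2 * Real.pi * i := by
    intro i
    induction i with
    | zero => intro _; simp [h.start]
    | succ i ih =>
      intro hi
      have h1 := ih (by omega)
      have h2 := abs_lt.1 ((h.step i (by omega)).abs_totalTurning_sub_lt N)
      push_cast
      linarith [h2.1]
  have h1 := hsteps k le_rfl
  have h2 := (abs_le.1 (h.convex.abs_totalTurning_le hN)).2
  linarith

/-- Every edge of a triangular spiral turns by `2π/3` relative to the preceding one. -/
lemma IsTriangularSpiral.totalTurning {m : ℕ} {p : Fin (n + 3) → ℂ} (h : IsTriangularSpiral m p)
    (hm : m ≤ n + 3) : totalTurning (cycleEdge p) (m - 2) = (m - 2 : ℕ) * (2 * Real.pi / 3) := by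
  have hedge : ∀ i, i + 1 < m → ∃ r : ℝ, 0 < r ∧
      cycleEdge p i = r * Complex.exp ((2 * Real.pi * (i : ℕ) / 3 : ℝ) * Complex.I) := by
    intro i hi
    have h1 : i % (n + 3) = i := Nat.mod_eq_of_lt (by omega)
    have h2 : (i + 1) % (n + 3) = i + 1 := Nat.mod_eq_of_lt (by omega)
    have := h (Fin.ofNat _ i) (Fin.ofNat _ (i + 1)) (by simp [h1, h2]) (by simp [h2, hi])
    simp only [Fin.val_ofNat, h1] at this
    exact this
  unfold PlaneDrawing.totalTurning
  rw [Finset.sum_congr rfl (g := fun _ => 2 * Real.pi / 3), Finset.sum_const, Finset.card_range,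
    nsmul_eq_mul]
  intro i hi
  have hi := Finset.mem_range.1 hi
  obtain ⟨r, hr, h1⟩ := hedge i (by omega)
  obtain ⟨s, hs, h2⟩ := hedge (i + 1) (by omega)
  have hq : cycleEdge p (i + 1) / cycleEdge p i =
      ((s / r : ℝ) : ℂ) * Complex.exp ((2 * Real.pi / 3 : ℝ) * Complex.I) := by
    rw [h1, h2, mul_div_mul_comm, ← Complex.exp_sub, Complex.ofReal_div s r, ← sub_mul,
      ← Complex.ofReal_sub]
    congr 4
    push_cast
    ring
  rw [hq, Complex.arg_real_mul _ (by positivity), Complex.arg_exp_mul_I,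
    (toIocMod_eq_self Real.two_pi_pos).2]
  constructor <;> linarith [Real.pi_pos]

end Cycle

/-! ### Coordinates in the three sectors of the plane -/

/-- The primitive third root of unity `exp (2πi/3)`. -/
noncomputable def cubeRoot : ℂ := Complex.exp ((2 * Real.pi / 3 : ℝ) * Complex.I)

lemma cubeRoot_pow (i : ℕ) :
    cubeRoot ^ i = Complex.exp ((2 * Real.pi * (i : ℕ) / 3 : ℝ) * Complex.I) := by
  rw [cubeRoot, ← Complex.exp_nat_mul]
  congr 1
  push_cast
  ring

lemma cubeRoot_pow_three : cubeRoot ^ 3 = 1 := by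
  rw [cubeRoot_pow, ← Complex.exp_two_pi_mul_I]
  congr 2
  push_cast
  ring

lemma cubeRoot_im_pos : 0 < cubeRoot.im := by
  rw [cubeRoot, Complex.exp_ofReal_mul_I_im]
  exact Real.sin_pos_of_pos_of_lt_pi (by positivity) (by linarith [Real.pi_pos])

lemma cubeRoot_sq : cubeRoot ^ 2 = -1 - cubeRoot := by
  have h1 : cubeRoot - 1 ≠ 0 := fun h => by
    have := cubeRoot_im_pos
    rw [sub_eq_zero.1 h] at this
    simp at this
  have h2 : (cubeRoot - 1) * (cubeRoot ^ 2 + cubeRoot + 1) = 0 := by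
    linear_combination cubeRoot_pow_three
  linear_combination (mul_eq_zero.1 h2).resolve_left h1

lemma real_combination_cubeRoot {a b c d : ℝ}
    (h : (a : ℂ) + b * cubeRoot = c + d * cubeRoot) : a = c ∧ b = d := by
  have him := congrArg Complex.im h
  have hre := congrArg Complex.re h
  simp at him hre
  have hbd := him.resolve_right cubeRoot_im_pos.ne'
  subst hbd
  exact ⟨by linarith, rfl⟩

/-- The normalizing factor which makes the first edge of the logarithmic spiral
`i ↦ (4 * cubeRoot) ^ i` equal to `1`. -/
noncomputable def spiralScale : ℂ := (4 * cubeRoot - 1)⁻¹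

lemma four_mul_cubeRoot_sub_one_ne_zero : 4 * cubeRoot - 1 ≠ 0 := fun h => by
  have := congrArg Complex.im h
  simp at this
  exact cubeRoot_im_pos.ne' this

lemma spiralScale_ne_zero : spiralScale ≠ 0 := inv_ne_zero four_mul_cubeRoot_sub_one_ne_zero

/-- The point with coordinates `u` and `v` in the sector between the `k`-th and the `(k+1)`-st of
the three rays (numbered modulo 3) that carry the vertices of the spirals. -/
noncomputable def sectorPoint (k : ℕ) (u v : ℝ) : ℂ :=
  spiralScale * (u * cubeRoot ^ k + v * cubeRoot ^ (k + 1))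

lemma sectorPoint_zero_left (k : ℕ) (v : ℝ) : sectorPoint k 0 v = sectorPoint (k + 1) v 0 := by
  simp [sectorPoint]

lemma sectorPoint_add_three (k : ℕ) (u v : ℝ) : sectorPoint (k + 3) u v = sectorPoint k u v := by
  have h1 : cubeRoot ^ (k + 3) = cubeRoot ^ k := by rw [pow_add, cubeRoot_pow_three, mul_one]
  have h2 : cubeRoot ^ (k + 3 + 1) = cubeRoot ^ (k + 1) := by rw [pow_succ, h1, pow_succ]
  rw [sectorPoint, h1, h2, sectorPoint]

lemma sectorPoint_combination (k : ℕ) (s t u v u' v' : ℝ) :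
    s • sectorPoint k u v + t • sectorPoint k u' v' =
      sectorPoint k (s * u + t * u') (s * v + t * v') := by
  simp only [sectorPoint, Complex.real_smul]
  push_cast
  ring

lemma continuous_sectorPoint (k : ℕ) : Continuous fun x : ℝ × ℝ => sectorPoint k x.1 x.2 := by
  unfold sectorPoint
  fun_prop

/-- Every point other than `0` has unique coordinates in a unique half-open sector. -/
lemma sectorPoint_inj {k l : ℕ} {u v u' v' : ℝ} (hu : 0 < u) (hv : 0 ≤ v) (hu' : 0 < u')
    (hv' : 0 ≤ v') (h : sectorPoint k u v = sectorPoint l u' v') :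
    k % 3 = l % 3 ∧ u = u' ∧ v = v' := by
  have hmod : ∀ k, cubeRoot ^ k = cubeRoot ^ (k % 3) := fun k => by
    conv_lhs => rw [← Nat.div_add_mod k 3, pow_add, pow_mul, cubeRoot_pow_three, one_pow, one_mul]
  have h := mul_left_cancel₀ spiralScale_ne_zero h
  rw [pow_succ, pow_succ, hmod k, hmod l] at h
  have hk : k % 3 < 3 := Nat.mod_lt _ (by norm_num)
  have hl : l % 3 < 3 := Nat.mod_lt _ (by norm_num)
  have hsq := cubeRoot_sq
  generalize k % 3 = k at h hk ⊢
  generalize l % 3 = l at h hl ⊢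
  -- the coordinates of both sides with respect to the basis `1, cubeRoot`
  have hexp : ∀ (k : ℕ) (u v : ℝ), k < 3 → (u : ℂ) * cubeRoot ^ k + v * (cubeRoot ^ k * cubeRoot) =
      ((if k = 0 then u else if k = 1 then -v else v - u : ℝ) : ℂ) +
      ((if k = 0 then v else if k = 1 then u - v else -u : ℝ) : ℂ) * cubeRoot := by
    intro k u v hk
    interval_cases k
    · simp
    · simp
      linear_combination (v : ℂ) * hsq
    · simp
      linear_combination ((u : ℂ) + v * (cubeRoot - 1)) * hsq
  rw [hexp k u v hk, hexp l u' v' hl] at h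
  obtain ⟨h1, h2⟩ := real_combination_cubeRoot h
  interval_cases k <;> interval_cases l <;> simp at h1 h2 ⊢ <;>
    first
      | exact ⟨by linarith, by linarith⟩
      | linarith

/-! ### The double spiral -/

/-- The ray that carries the vertex `j` of the double spiral on `n` vertices: the inner spiral
takes the rays `0, …, n / 2 - 1` in increasing order, the outer one leads back from the ray `n / 2`
to the ray `1` or, for odd `n`, to the ray `0`. -/
def spiralRay (n j : ℕ) : ℕ := if j < n / 2 then j else 2 * (n / 2) - j

/-- The binary logarithm of the distance of the vertex `j` of the double spiral from the centre, up
to normalization: `2 k` on the ray `k` for the inner spiral, and `2 k + 3` for the outer one. -/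
def spiralExp (n j : ℕ) : ℕ := if j < n / 2 then 2 * j else 2 * (2 * (n / 2) - j) + 3

/-- The drawing of the cycle on `n` vertices as a thin strip wound up into a spiral: a multiple of
the logarithmic spiral `k ↦ (4 * cubeRoot) ^ k` is followed by its copy scaled by the factor `8`,
run backwards. The factor lies between `1` and `64 = 4 ^ 3`, at which the inner spiral arrives after
a full winding. -/
noncomputable def doubleSpiral (n : ℕ) (j : Fin n) : ℂ :=
  sectorPoint (spiralRay n j) (2 ^ spiralExp n j) 0

section Indices

variable {n : ℕ}

lemma spiralExp_eq (n j : ℕ) :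
    spiralExp n j = 2 * spiralRay n j ∨ spiralExp n j = 2 * spiralRay n j + 3 := by
  unfold spiralExp spiralRay
  split_ifs <;> simp

lemma spiralExp_injective {u v : Fin n} (h : spiralExp n u = spiralExp n v) : u = v := by
  have hu := u.isLt
  have hv := v.isLt
  unfold spiralExp at h
  ext
  split_ifs at h <;> omega

/-- The edge from `u` to `v` leads from one ray to the next. The three cases are the edges of the
inner spiral, those of the outer one, and those that connect the two. -/
def IsSectorEdge (n u v : ℕ) : Prop :=
  spiralRay n v = spiralRay n u + 1 ∧
    ((spiralExp n u = 2 * spiralRay n u ∧ spiralExp n v = 2 * spiralRay n u + 2 ∧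
        spiralRay n u + 2 ≤ n / 2) ∨
      (spiralExp n u = 2 * spiralRay n u + 3 ∧ spiralExp n v = 2 * spiralRay n u + 5 ∧
        spiralRay n u + 1 ≤ n / 2) ∨
      (spiralExp n u = 2 * spiralRay n u ∧ spiralExp n v = 2 * spiralRay n u + 5 ∧
        (spiralRay n u = 0 ∨ spiralRay n u + 1 = n / 2)))

/-- The edge from `u` to `v` lies on the ray `0` and connects the innermost ends of the two
spirals. It is present for odd `n` only. -/
def IsRadialEdge (n u v : ℕ) : Prop :=
  spiralRay n u = 0 ∧ spiralRay n v = 0 ∧ spiralExp n u = 0 ∧ spiralExp n v = 3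

lemma cycleGraph_adj_val (hn : 3 ≤ n) {u v : Fin n} (h : (SimpleGraph.cycleGraph n).Adj u v) :
    (v : ℕ) = u + 1 ∨ (u : ℕ) = v + 1 ∨ ((u : ℕ) = 0 ∧ (v : ℕ) = n - 1) ∨
      ((v : ℕ) = 0 ∧ (u : ℕ) = n - 1) := by
  have hu := u.isLt
  have hv := v.isLt
  rw [SimpleGraph.cycleGraph_adj', Fin.val_sub, Fin.val_sub] at h
  rcases lt_trichotomy (u : ℕ) v with h' | h' | h'
  · rw [Nat.mod_eq_of_lt (show n - (v : ℕ) + u < n by omega),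
      Nat.mod_eq_sub_mod (show n ≤ n - (u : ℕ) + v by omega),
      Nat.mod_eq_of_lt (show n - (u : ℕ) + v - n < n by omega)] at h
    omega
  · rw [h', Nat.sub_add_cancel hv.le, Nat.mod_self] at h
    omega
  · rw [Nat.mod_eq_of_lt (show n - (u : ℕ) + v < n by omega),
      Nat.mod_eq_sub_mod (show n ≤ n - (v : ℕ) + u by omega),
      Nat.mod_eq_of_lt (show n - (v : ℕ) + u - n < n by omega)] at h
    omega

lemma edge_classification (hn : 3 ≤ n) {u v : Fin n} (h : (SimpleGraph.cycleGraph n).Adj u v) :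
    (IsSectorEdge n u v ∨ IsRadialEdge n u v) ∨ (IsSectorEdge n v u ∨ IsRadialEdge n v u) := by
  have hu := u.isLt
  have hv := v.isLt
  have hsucc : ∀ i : ℕ, i + 1 < n → IsSectorEdge n i (i + 1) ∨ IsSectorEdge n (i + 1) i := by
    intro i hi
    unfold IsSectorEdge spiralRay spiralExp
    split_ifs <;> omega
  have hlast : IsSectorEdge n 0 (n - 1) ∨ IsRadialEdge n 0 (n - 1) := by
    unfold IsSectorEdge IsRadialEdge spiralRay spiralExp
    split_ifs <;> omega
  rcases cycleGraph_adj_val hn h with h | h | ⟨h1, h2⟩ | ⟨h1, h2⟩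
  · rw [h]
    rcases hsucc u (by omega) with h' | h' <;> tauto
  · rw [h]
    rcases hsucc v (by omega) with h' | h' <;> tauto
  · rw [h1, h2]; exact Or.inl hlast
  · rw [h1, h2]; exact Or.inr hlast

/-- The edges in one sector are linearly ordered by their distance from the centre. -/
lemma IsSectorEdge.le_or_le {u v w x : ℕ} (h : IsSectorEdge n u v) (h' : IsSectorEdge n w x)
    (hmod : spiralRay n u % 3 = spiralRay n w % 3) :
    (spiralExp n u ≤ spiralExp n w ∧ spiralExp n v ≤ spiralExp n x) ∨
      (spiralExp n w ≤ spiralExp n u ∧ spiralExp n x ≤ spiralExp n v) := by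
  obtain ⟨-, h⟩ := h
  obtain ⟨-, h'⟩ := h'
  rcases h with ⟨h1, h2, h3⟩ | ⟨h1, h2, h3⟩ | ⟨h1, h2, h3⟩ <;>
    rcases h' with ⟨h4, h5, h6⟩ | ⟨h4, h5, h6⟩ | ⟨h4, h5, h6⟩ <;> rw [h1, h2, h4, h5] <;> omega

end Indices

section Planarity

variable {n : ℕ}

lemma IsSectorEdge.combination {u v : Fin n} (h : IsSectorEdge n u v) (s t : ℝ) :
    s • doubleSpiral n u + t • doubleSpiral n v =
      sectorPoint (spiralRay n u) (s * 2 ^ spiralExp n u) (t * 2 ^ spiralExp n v) := by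
  rw [doubleSpiral, doubleSpiral, h.1, ← sectorPoint_zero_left, sectorPoint_combination]
  simp

lemma IsRadialEdge.combination {u v : Fin n} (h : IsRadialEdge n u v) (s t : ℝ) :
    s • doubleSpiral n u + t • doubleSpiral n v = sectorPoint 0 (s + t * 8) 0 := by
  obtain ⟨h1, h2, h3, h4⟩ := h
  rw [doubleSpiral, doubleSpiral, h1, h2, h3, h4, sectorPoint_combination]
  norm_num

lemma doubleSpiral_injective : Function.Injective (doubleSpiral n) := by
  intro u v h
  have := (sectorPoint_inj (by positivity) le_rfl (by positivity) le_rfl h).2.1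
  exact spiralExp_injective (pow_right_injective₀ (by norm_num) (by norm_num) this)

lemma vertex_of_mem_segment {u v w : Fin n} (h : IsSectorEdge n u v ∨ IsRadialEdge n u v)
    (hw : doubleSpiral n w ∈ segment ℝ (doubleSpiral n u) (doubleSpiral n v)) :
    w = u ∨ w = v := by
  obtain ⟨s, t, hs, ht, hst, hz⟩ := hw
  rcases hs.eq_or_lt with rfl | hs
  · right
    obtain rfl : t = 1 := by linarith
    exact doubleSpiral_injective (by rw [← hz]; simp)
  rcases ht.eq_or_lt with rfl | ht
  · left
    obtain rfl : s = 1 := by linarith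
    exact doubleSpiral_injective (by rw [← hz]; simp)
  rcases h with h | h
  · rw [h.combination] at hz
    have := (sectorPoint_inj (by positivity) (by positivity) (by positivity) le_rfl hz).2.2
    have h0 : 0 < t * (2 : ℝ) ^ spiralExp n v := by positivity
    exact absurd this h0.ne'
  · rw [h.combination] at hz
    obtain ⟨hmod, hexp, -⟩ := sectorPoint_inj (by positivity) le_rfl (by positivity) le_rfl hz
    have hlt : (2 : ℝ) ^ spiralExp n w < 2 ^ 3 := by rw [← hexp]; linarith
    have hlt := (pow_lt_pow_iff_right₀ (by norm_num : (1 : ℝ) < 2)).1 hlt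
    left
    apply spiralExp_injective
    rw [h.2.2.1]
    rcases spiralExp_eq n w with h' | h' <;> omega

lemma disjoint_openSegment {u v w x : Fin n} (h : IsSectorEdge n u v ∨ IsRadialEdge n u v)
    (h' : IsSectorEdge n w x ∨ IsRadialEdge n w x) (hne : s(u, v) ≠ s(w, x)) :
    Disjoint (openSegment ℝ (doubleSpiral n u) (doubleSpiral n v))
      (openSegment ℝ (doubleSpiral n w) (doubleSpiral n x)) := by
  rw [Set.disjoint_left]
  rintro z ⟨s, t, hs, ht, hst, hz⟩ ⟨s', t', hs', ht', hst', hz'⟩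
  rw [← hz'] at hz
  rcases h with h | h <;> rcases h' with h' | h'
  · rw [h.combination, h'.combination] at hz
    obtain ⟨hmod, h1, h2⟩ :=
      sectorPoint_inj (by positivity) (by positivity) (by positivity) (by positivity) hz
    have key : ∀ {a b a' b' : ℕ} {s t s' t' : ℝ}, 0 < s → 0 < t → s + t = 1 → s' + t' = 1 →
        s * 2 ^ a = s' * 2 ^ a' → t * 2 ^ b = t' * 2 ^ b' → 0 < s' → 0 < t' →
        a ≤ a' → b ≤ b' → a = a' ∧ b = b' := by
      intro a b a' b' s t s' t' hs ht hst hst' h1 h2 hs' ht' ha hb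
      have ha2 : (2 : ℝ) ^ a ≤ 2 ^ a' := pow_le_pow_right₀ (by norm_num) ha
      have hb2 : (2 : ℝ) ^ b ≤ 2 ^ b' := pow_le_pow_right₀ (by norm_num) hb
      have pa : (0 : ℝ) < 2 ^ a := by positivity
      have pb : (0 : ℝ) < 2 ^ b := by positivity
      have hss : s' ≤ s := le_of_mul_le_mul_right
        (h1 ▸ mul_le_mul_of_nonneg_left ha2 hs'.le) pa
      have htt : t' ≤ t := le_of_mul_le_mul_right
        (h2 ▸ mul_le_mul_of_nonneg_left hb2 ht'.le) pb
      obtain rfl : s = s' := by linarith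
      obtain rfl : t = t' := by linarith
      exact ⟨pow_right_injective₀ (by norm_num) (by norm_num) (mul_left_cancel₀ hs.ne' h1),
        pow_right_injective₀ (by norm_num) (by norm_num) (mul_left_cancel₀ ht.ne' h2)⟩
    apply hne
    rcases h.le_or_le h' hmod with ⟨ha, hb⟩ | ⟨ha, hb⟩
    · obtain ⟨e1, e2⟩ := key hs ht hst hst' h1 h2 hs' ht' ha hb
      rw [spiralExp_injective e1, spiralExp_injective e2]
    · obtain ⟨e1, e2⟩ := key hs' ht' hst' hst h1.symm h2.symm hs ht ha hb
      rw [spiralExp_injective e1, spiralExp_injective e2]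
  · rw [h.combination, h'.combination] at hz
    have := (sectorPoint_inj (by positivity) (by positivity) (by positivity) le_rfl hz).2.2
    have h0 : 0 < t * (2 : ℝ) ^ spiralExp n v := by positivity
    exact h0.ne' this
  · rw [h.combination, h'.combination] at hz
    have := (sectorPoint_inj (by positivity) le_rfl (by positivity) (by positivity) hz).2.2
    have h0 : 0 < t' * (2 : ℝ) ^ spiralExp n x := by positivity
    exact h0.ne this
  · apply hne
    rw [spiralExp_injective (h.2.2.1.trans h'.2.2.1.symm),
      spiralExp_injective (h.2.2.2.trans h'.2.2.2.symm)]

theorem isPlanarDrawing_doubleSpiral (hn : 3 ≤ n) :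
    IsPlanarDrawing (SimpleGraph.cycleGraph n) (doubleSpiral n) where
  injective := doubleSpiral_injective
  vertex_edge u v w huv hw := by
    rcases edge_classification hn huv with h | h
    · exact vertex_of_mem_segment h hw
    · exact (vertex_of_mem_segment h (segment_symm ℝ (doubleSpiral n u) _ ▸ hw)).symm
  edge_edge u v w x huv hwx hne := by
    rcases edge_classification hn huv with h | h <;> rcases edge_classification hn hwx with h' | h'
    · exact disjoint_openSegment h h' hne
    · rw [openSegment_symm ℝ (doubleSpiral n w)]
      exact disjoint_openSegment h h' (by rwa [Sym2.eq_swap (a := x)])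
    · rw [openSegment_symm ℝ (doubleSpiral n u)]
      exact disjoint_openSegment h h' (by rwa [Sym2.eq_swap (a := v)])
    · rw [openSegment_symm ℝ (doubleSpiral n u), openSegment_symm ℝ (doubleSpiral n w)]
      exact disjoint_openSegment h h' (by rwa [Sym2.eq_swap (a := v), Sym2.eq_swap (a := x)])

theorem isTriangularSpiral_doubleSpiral : IsTriangularSpiral (n / 2) (doubleSpiral n) := by
  intro i j hij hj
  refine ⟨4 ^ (i : ℕ), by positivity, ?_⟩
  have hvert : ∀ l : Fin n, (l : ℕ) < n / 2 →
      doubleSpiral n l = spiralScale * (4 * cubeRoot) ^ (l : ℕ) := by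
    intro l hl
    simp only [doubleSpiral, sectorPoint, spiralRay, spiralExp, if_pos hl]
    rw [pow_mul, mul_pow]
    norm_num
  rw [hvert j hj, hvert i (by omega), ← cubeRoot_pow, hij, pow_succ, spiralScale]
  have := four_mul_cubeRoot_sub_one_ne_zero
  push_cast
  rw [← mul_pow]
  field_simp

end Planarity

/-! ### The outer face of the double spiral -/

section OuterFace

variable {n : ℕ}

/-- The strip between the inner spiral and the preceding winding of the outer one, which is at
`1 / 8` of its distance from the centre, continued to infinity. -/
def corridor : Set ℂ :=
  ⋃ k : ℕ, (fun x : ℝ × ℝ => sectorPoint k x.1 x.2) ''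
    {x | 0 ≤ x.1 ∧ 0 ≤ x.2 ∧ 4 ^ k / 8 < x.1 + x.2 / 4 ∧ x.1 + x.2 / 4 < 4 ^ k}

lemma sectorPoint_mem_corridor {k : ℕ} {u : ℝ} (hu : u ∈ Set.Ioo ((4 : ℝ) ^ k / 8) (4 ^ k)) :
    sectorPoint k u 0 ∈ corridor := by
  have h0 : (0 : ℝ) < 4 ^ k / 8 := by positivity
  exact Set.mem_iUnion.2 ⟨k, (u, 0), ⟨(h0.trans hu.1).le, le_rfl, by simpa using hu.1,
    by simpa using hu.2⟩, rfl⟩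

lemma isPreconnected_corridor : IsPreconnected corridor := by
  refine IsPreconnected.iUnion_of_chain (fun k => ?_) (fun k => ?_)
  · refine IsPreconnected.image ?_ _ (continuous_sectorPoint k).continuousOn
    refine Convex.isPreconnected ?_
    rintro ⟨a, b⟩ ⟨ha, hb, h1, h2⟩ ⟨c, d⟩ ⟨hc, hd, h3, h4⟩ s t hs ht hst
    simp only at ha hb h1 h2 hc hd h3 h4
    have hc1 := (convex_Ioo ((4 : ℝ) ^ k / 8) (4 ^ k)) ⟨h1, h2⟩ ⟨h3, h4⟩ hs ht hst
    simp only [smul_eq_mul, Set.mem_Ioo] at hc1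
    simp only [Set.mem_ofPred_eq, Prod.smul_mk, Prod.mk_add_mk, smul_eq_mul]
    refine ⟨by positivity, by positivity, ?_, ?_⟩ <;> linarith [hc1.1, hc1.2]
  · have h0 : (0 : ℝ) < 4 ^ k := by positivity
    refine ⟨sectorPoint k 0 (2 * 4 ^ k), ⟨(0, 2 * 4 ^ k), ⟨le_rfl, by positivity, ?_, ?_⟩, rfl⟩, ?_⟩
    · simp only; linarith
    · simp only; linarith
    · rw [sectorPoint_zero_left]
      refine ⟨(2 * 4 ^ k, 0), ⟨by positivity, le_rfl, ?_, ?_⟩, rfl⟩ <;>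
      · simp only [Nat.succ_eq_succ, Nat.succ_eq_add_one, pow_succ]
        linarith

lemma not_isBounded_corridor : ¬ Bornology.IsBounded corridor := by
  intro h
  obtain ⟨R, hR⟩ := h.exists_norm_le
  have hc : 0 < ‖spiralScale‖ := norm_pos_iff.2 spiralScale_ne_zero
  obtain ⟨k, hk⟩ := pow_unbounded_of_one_lt (2 * R / ‖spiralScale‖) (by norm_num : (1 : ℝ) < 4)
  have h0 : (0 : ℝ) < 4 ^ k := by positivity
  have h1 := hR _ (sectorPoint_mem_corridor (k := k) (u := 4 ^ k / 2)
    ⟨by linarith, by linarith⟩)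
  have hω : ‖cubeRoot‖ = 1 := Complex.norm_exp_ofReal_mul_I _
  rw [sectorPoint, norm_mul, Complex.ofReal_zero, zero_mul, add_zero, norm_mul, norm_pow, hω,
    one_pow, mul_one, Complex.norm_real, Real.norm_of_nonneg (by positivity)] at h1
  rw [div_lt_iff₀ hc] at hk
  linarith

lemma exists_sectorPoint_of_mem_drawingSet (hn : 3 ≤ n) {z : ℂ}
    (hz : z ∈ drawingSet (SimpleGraph.cycleGraph n) (doubleSpiral n)) :
    ∃ (k : ℕ) (u v : ℝ), 0 < u ∧ 0 ≤ v ∧ 4 ^ k ≤ u + v / 4 ∧ u + v / 4 ≤ 8 * 4 ^ k ∧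
      z = sectorPoint k u v := by
  have hpow : ∀ {a k : ℕ}, 2 * k ≤ a → a ≤ 2 * k + 3 →
      (4 : ℝ) ^ k ≤ 2 ^ a ∧ (2 : ℝ) ^ a ≤ 8 * 4 ^ k := by
    intro a k h1 h2
    have e1 : (4 : ℝ) ^ k = 2 ^ (2 * k) := by rw [pow_mul]; norm_num
    have e2 : (8 : ℝ) * 4 ^ k = 2 ^ (2 * k + 3) := by rw [e1, pow_add]; ring
    rw [e2, e1]
    exact ⟨pow_le_pow_right₀ (by norm_num) h1, pow_le_pow_right₀ (by norm_num) h2⟩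
  have hvert : ∀ w : Fin n, ∃ (k : ℕ) (u v : ℝ), 0 < u ∧ 0 ≤ v ∧ 4 ^ k ≤ u + v / 4 ∧
      u + v / 4 ≤ 8 * 4 ^ k ∧ doubleSpiral n w = sectorPoint k u v := by
    intro w
    have h := hpow (a := spiralExp n w) (k := spiralRay n w)
      (by rcases spiralExp_eq n w with h | h <;> omega)
      (by rcases spiralExp_eq n w with h | h <;> omega)
    exact ⟨spiralRay n w, 2 ^ spiralExp n w, 0, by positivity, le_rfl, by simpa using h.1,
      by simpa using h.2, rfl⟩
  have hedge : ∀ u v : Fin n, (IsSectorEdge n u v ∨ IsRadialEdge n u v) →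
      z ∈ segment ℝ (doubleSpiral n u) (doubleSpiral n v) →
      ∃ (k : ℕ) (u v : ℝ), 0 < u ∧ 0 ≤ v ∧ 4 ^ k ≤ u + v / 4 ∧
      u + v / 4 ≤ 8 * 4 ^ k ∧ z = sectorPoint k u v := by
    rintro u v h ⟨s, t, hs, ht, hst, rfl⟩
    rcases hs.eq_or_lt with rfl | hs
    · obtain rfl : t = 1 := by linarith
      simpa using hvert v
    rcases h with h | h
    · refine ⟨_, _, _, ?_, ?_, ?_, ?_, h.combination s t⟩
      · positivity
      · positivity
      all_goals
        have h1 := hpow (a := spiralExp n u) (k := spiralRay n u) (by have := h.2; omega)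
          (by have := h.2; omega)
        have h2 := hpow (a := spiralExp n v) (k := spiralRay n u + 1) (by have := h.2; omega)
          (by have := h.2; omega)
        rw [pow_succ] at h2
        generalize (2 : ℝ) ^ spiralExp n u = x at *
        generalize (2 : ℝ) ^ spiralExp n v = y at *
        generalize (4 : ℝ) ^ spiralRay n u = r at *
        obtain rfl : s = 1 - t := by linarith
        nlinarith
    · refine ⟨_, _, _, ?_, le_rfl, ?_, ?_, h.combination s t⟩ <;> norm_num <;> linarith
  rcases hz with ⟨w, rfl⟩ | ⟨u, v, huv, hz⟩
  · exact hvert w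
  · rcases edge_classification hn huv with h | h
    · exact hedge u v h hz
    · exact hedge v u h (segment_symm ℝ (doubleSpiral n u) _ ▸ hz)

lemma corridor_subset_compl_drawingSet (hn : 3 ≤ n) :
    corridor ⊆ (drawingSet (SimpleGraph.cycleGraph n) (doubleSpiral n))ᶜ := by
  intro z hz hzD
  obtain ⟨l, u', v', hu', hv', h1, h2, rfl⟩ := exists_sectorPoint_of_mem_drawingSet hn hzD
  -- coordinates in a half-open sector
  obtain ⟨k, u, v, hu, hv, h3, h4, heq⟩ : ∃ (k : ℕ) (u v : ℝ), 0 < u ∧ 0 ≤ v ∧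
      4 ^ k / 8 < u + v / 4 ∧ u + v / 4 < 4 ^ k ∧ sectorPoint k u v = sectorPoint l u' v' := by
    obtain ⟨k, ⟨u, v⟩, ⟨hu, hv, h3, h4⟩, heq⟩ := Set.mem_iUnion.1 hz
    simp only at hu hv h3 h4 heq
    rcases hu.eq_or_lt with rfl | hu
    · have h0 : (0 : ℝ) < 4 ^ k := by positivity
      refine ⟨k + 1, v, 0, by linarith, le_rfl, ?_, ?_, sectorPoint_zero_left k v ▸ heq⟩ <;>
      · rw [pow_succ]
        linarith
    · exact ⟨k, u, v, hu, hv, h3, h4, heq⟩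
  obtain ⟨hmod, rfl, rfl⟩ := sectorPoint_inj hu hv hu' hv' heq
  rcases le_or_gt k l with hkl | hkl
  · have : (4 : ℝ) ^ k ≤ 4 ^ l := pow_le_pow_right₀ (by norm_num) hkl
    linarith
  · have : (4 : ℝ) ^ (l + 3) ≤ 4 ^ k := pow_le_pow_right₀ (by norm_num) (by omega)
    rw [pow_add] at this
    linarith

lemma doubleSpiral_mem_closure_corridor (j : Fin n) : doubleSpiral n j ∈ closure corridor := by
  have hcont : ∀ k, Continuous fun u : ℝ => sectorPoint k u 0 := fun k =>
    (continuous_sectorPoint k).comp (Continuous.prodMk continuous_id continuous_const)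
  have key : ∀ (k : ℕ) (u : ℝ), u ∈ Set.Icc ((4 : ℝ) ^ k / 8) (4 ^ k) →
      sectorPoint k u 0 ∈ closure corridor := by
    intro k u hu
    have h0 : (0 : ℝ) < 4 ^ k := by positivity
    rw [← closure_Ioo (by linarith : (4 : ℝ) ^ k / 8 ≠ 4 ^ k)] at hu
    refine closure_mono ?_ (image_closure_subset_closure_image (hcont k) ⟨u, hu, rfl⟩)
    rintro _ ⟨u, hu, rfl⟩
    exact sectorPoint_mem_corridor hu
  have e1 : (2 : ℝ) ^ (2 * spiralRay n j) = 4 ^ spiralRay n j := by rw [pow_mul]; norm_num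
  have h0 : (0 : ℝ) < 4 ^ spiralRay n j := by positivity
  rw [doubleSpiral]
  rcases spiralExp_eq n j with h | h
  · rw [h, e1]
    exact key _ _ ⟨by linarith, le_rfl⟩
  · rw [h, pow_add, e1, ← sectorPoint_add_three]
    refine key _ _ ⟨?_, ?_⟩ <;> rw [pow_add] <;> linarith

theorem onOuterFace_doubleSpiral (hn : 3 ≤ n) (j : Fin n) :
    OnOuterFace (SimpleGraph.cycleGraph n) (doubleSpiral n) j := by
  have hw : sectorPoint 0 (1 / 2) 0 ∈ corridor := sectorPoint_mem_corridor (by norm_num)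
  have hsub := corridor_subset_compl_drawingSet hn
  have hF := isPreconnected_corridor.subset_connectedComponentIn hw hsub
  refine ⟨_, ⟨_, hsub hw, rfl⟩, fun h => not_isBounded_corridor (h.subset hF),
    closure_mono hF (doubleSpiral_mem_closure_corridor j), fun h => ?_⟩
  exact connectedComponentIn_subset _ _ (interior_subset h) (vertex_mem_drawingSet j)

end OuterFace

/-! ### Connectivity of cycles -/

lemma isTwoConnected_cycleGraph (n : ℕ) : IsTwoConnected (SimpleGraph.cycleGraph (n + 3)) := by
  refine ⟨by simp, SimpleGraph.cycleGraph_connected, fun v => ?_⟩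
  have hne : ∀ j, j < n + 2 → Fin.ofNat (n + 3) (v.val + 1 + j) ∈ ({v}ᶜ : Set (Fin (n + 3))) := by
    intro j hj h
    have h := congrArg Fin.val (Set.mem_singleton_iff.1 h)
    rw [Fin.val_ofNat] at h
    have hv := v.isLt
    rcases lt_or_ge (v.val + 1 + j) (n + 3) with h' | h'
    · rw [Nat.mod_eq_of_lt h'] at h
      omega
    · rw [Nat.mod_eq_sub_mod h', Nat.mod_eq_of_lt (by omega)] at h
      omega
  have hreach : ∀ j (hj : j < n + 2),
      ((SimpleGraph.cycleGraph (n + 3)).induce ({v}ᶜ : Set (Fin (n + 3)))).Reachable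
        ⟨_, hne 0 (by omega)⟩ ⟨_, hne j hj⟩ := by
    intro j
    induction j with
    | zero => intro _; exact SimpleGraph.Reachable.refl _
    | succ j ih =>
      intro hj
      refine (ih (by omega)).trans (SimpleGraph.Adj.reachable ?_)
      exact cycleGraph_adj_ofNat (v.val + 1 + j)
  rw [SimpleGraph.connected_iff_exists_forall_reachable]
  refine ⟨⟨_, hne 0 (by omega)⟩, ?_⟩
  rintro ⟨w, hw⟩
  have hwv : w.val ≠ v.val := fun h => hw (Fin.ext h)
  have hv := v.isLt
  have hw' := w.isLt
  obtain ⟨j, hj, rfl⟩ : ∃ j, j < n + 2 ∧ w = Fin.ofNat (n + 3) (v.val + 1 + j) := by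
    rcases lt_or_gt_of_ne hwv with h | h
    · refine ⟨w.val + (n + 3) - v.val - 1, by omega, Fin.ext ?_⟩
      rw [Fin.val_ofNat, show v.val + 1 + (w.val + (n + 3) - v.val - 1) = w.val + (n + 3) by omega,
        Nat.add_mod_right, Nat.mod_eq_of_lt hw']
    · refine ⟨w.val - v.val - 1, by omega, Fin.ext ?_⟩
      rw [Fin.val_ofNat, show v.val + 1 + (w.val - v.val - 1) = w.val by omega,
        Nat.mod_eq_of_lt hw']
  exact hreach j hj

/-- A drawing of a cycle with all vertices on the outer face is internally 3-connected. -/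
lemma isInternallyThreeConnected_cycleGraph {n : ℕ} {p : Fin (n + 3) → ℂ}
    (h : ∀ v, OnOuterFace (SimpleGraph.cycleGraph (n + 3)) p v) :
    IsInternallyThreeConnected (SimpleGraph.cycleGraph (n + 3)) p :=
  ⟨isTwoConnected_cycleGraph n, fun u v _ => ⟨h u, h v, fun C => by
    obtain ⟨w, rfl⟩ := C.exists_rep
    exact ⟨w, rfl, h w⟩⟩⟩

end PlaneDrawing

open PlaneDrawing in
theorem theorem3 :
    ∃ Γ : (n : ℕ) → Fin n → ℂ,
      (∀ n : ℕ, 3 ≤ n →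
        IsPlanarDrawing (SimpleGraph.cycleGraph n) (Γ n) ∧
        IsInternallyThreeConnected (SimpleGraph.cycleGraph n) (Γ n) ∧
        IsTriangularSpiral (n / 2) (Γ n)) ∧
      ∃ c : ℝ, 0 < c ∧ ∀ᶠ n : ℕ in atTop,
        ∀ (k : ℕ) (Δ : ℕ → Fin n → ℂ),
          IsConvexifyingMorph (SimpleGraph.cycleGraph n) (Γ n) k Δ → c * (n : ℝ) ≤ (k : ℝ) := by
  refine ⟨doubleSpiral, fun n hn => ⟨isPlanarDrawing_doubleSpiral hn, ?_,
    isTriangularSpiral_doubleSpiral⟩, 1 / 12, by norm_num, ?_⟩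
  · obtain ⟨n, rfl⟩ := Nat.exists_eq_add_of_le' hn
    exact isInternallyThreeConnected_cycleGraph (onOuterFace_doubleSpiral hn)
  · filter_upwards [eventually_ge_atTop 22] with n hn k Δ h
    obtain ⟨n, rfl⟩ := Nat.exists_eq_add_of_le' (show 3 ≤ n by omega)
    have h1 := h.totalTurning_le (N := (n + 3) / 2 - 2) (by omega)
    rw [isTriangularSpiral_doubleSpiral.totalTurning (by omega)] at h1
    -- `(n + 3) / 2 - 2` exterior angles of `2π/3` are at most `k + 1` full turns
    have h2 : (((n + 3) / 2 - 2 : ℕ) : ℝ) ≤ 3 * (k + 1) := by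
      have h3 : Real.pi * (((n + 3) / 2 - 2 : ℕ) : ℝ) ≤ Real.pi * (3 * (k + 1)) := by linarith
      exact le_of_mul_le_mul_left h3 Real.pi_pos
    have h4 : (n + 3) / 2 - 2 ≤ 3 * (k + 1) := by exact_mod_cast h2
    have h5 : n + 3 ≤ 12 * k := by omega
    have h6 : ((n + 3 : ℕ) : ℝ) ≤ 12 * k := by exact_mod_cast h5
    linarith
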